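/- Let $k$ be an algebraically closed field of characteristic $0$ and let $\mathfrak f=\mathfrak f_1=\mathfrak{sl}(1|1)$, with basis $t$ of the even part and $x=E_{12}$, $y=E_{21}$ of the odd part, so that $t=[x,y]$ is the identity matrix. Let $\mathcal F$ be the category of finite dimensional $\mathfrak f$-supermodules that are completely reducible over the even part $\mathfrak f_{\bar 0}=kt$ (with even homomorphisms). For an odd element $z$, a supermodule $M$ has Jordan type $a_1[1]+a_2[2]$ at $z$ if its restriction to the subsuperalgebra $\langle z\rangle$ generated by $z$ is a direct sum of $a_1$ one-dimensional trivial modules (each even or odd) and $a_2$ copies of $k[z]/z^2$ (up to parity change); $M$ is of strong constant Jordan type $a_1[1]+a_2[2]$ if it has this Jordan type at every nonzero odd element $z\in\mathfrak f_{\bar 1}$. A supermodule $M\in\mathcal F$ is endotrivial if $M\otimes M^*\cong k_{ev}\oplus P$ with $P$ projective in $\mathcal F$, where $k_{ev}$ is the even trivial module. For $n\ge 1$, let $W_{n,2}$ be the $\mathfrak f$-supermodule with even basis $v_1,\dots,v_n$ and odd basis $w_1,\dots,w_{n-1}$, on which $t$ acts by zero and $$x v_1=0,\qquad x v_{i+1}=w_i=y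 v_i\ (1\le i\le n-1),\qquad y v_n=0,\qquad x w_i=y w_i=0 .$$ **Theorem.** Let $M\in\mathcal F$ be an indecomposable supermodule over $\mathfrak f_1=\mathfrak{sl}(1|1)$ which is not projective in $\mathcal F$ and which is of strong constant Jordan type $a_1[1]+a_2[2]$. Then $a_1=1$, and $M$ is endotrivial. Moreover, for some $n\ge 1$, $M$ is isomorphic, up to parity change, to $W_{n,2}$ or to its dual $W_{n,2}^*$. -/

import Mathlib

universe u

namespace SL11

open scoped TensorProduct

/-- The sign `(-1)^(i j)` of the Koszul rule, for parities `i j : ZMod 2`. -/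
def koszul (i j : ZMod 2) : ℤ := (-1) ^ (i.val * j.val)

/-- The supertrace of a `(1|1)` by `(1|1)` matrix; rows and columns are indexed by their parity. -/
def supertrace (k : Type u) [Field k] : Matrix (ZMod 2) (ZMod 2) k →ₗ[k] k where
  toFun A := A 0 0 - A 1 1
  map_add' A B := by simp; ring
  map_smul' c A := by simp; ring

/-- The homogeneous component of parity `i` of a matrix: the entry `(a, b)` has parity `a + b`. -/
def matComp (k : Type u) [Field k] (i : ZMod 2) :
    Matrix (ZMod 2) (ZMod 2) k →ₗ[k] Matrix (ZMod 2) (ZMod 2) k where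
  toFun A := Matrix.of fun a b => if a + b = i then A a b else 0
  map_add' A B := by ext a b; by_cases h : a + b = i <;> simp [h]
  map_smul' c A := by ext a b; by_cases h : a + b = i <;> simp [h]

/-- The superbracket of `gl(1|1)`: the bilinear extension of
`[A, B] = A B - (-1)^(|A| |B|) B A` for homogeneous `A`, `B`. -/
def matBracket {k : Type u} [Field k] (A B : Matrix (ZMod 2) (ZMod 2) k) :
    Matrix (ZMod 2) (ZMod 2) k :=
  ∑ i : ZMod 2, ∑ j : ZMod 2,
    (matComp k i A * matComp k j B - koszul i j • (matComp k j B * matComp k i A))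

/-- The underlying vector space of `sl(1|1)`: the matrices of supertrace zero. -/
abbrev sl11 (k : Type u) [Field k] : Submodule k (Matrix (ZMod 2) (ZMod 2) k) :=
  LinearMap.ker (supertrace k)

theorem univ_eq : (Finset.univ : Finset (ZMod 2)) = {0, 1} := rfl

theorem parity_cases (i : ZMod 2) : i = 0 ∨ i = 1 := by
  revert i; decide

theorem matComp_mem {k : Type u} [Field k] (i : ZMod 2) (A : sl11 k) :
    matComp k i A.1 ∈ sl11 k := by
  have hA := A.2
  simp only [LinearMap.mem_ker, supertrace, LinearMap.coe_mk, AddHom.coe_mk] at hA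
  have h2 : (1 + 1 : ZMod 2) = 0 := rfl
  rcases parity_cases i with rfl | rfl <;> simp [supertrace, matComp, hA, h2]

theorem matBracket_mem {k : Type u} [Field k] (A B : Matrix (ZMod 2) (ZMod 2) k) :
    matBracket A B ∈ sl11 k := by
  have h2 : (1 + 1 : ZMod 2) = 0 := rfl
  simp [supertrace, matBracket, matComp, koszul, univ_eq, Matrix.mul_apply, ZMod.val_one, h2]
  ring

/-- The homogeneous component of parity `i` of an element of `sl(1|1)`. -/
def comp {k : Type u} [Field k] (i : ZMod 2) : sl11 k →ₗ[k] sl11 k :=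
  ((matComp k i).comp (sl11 k).subtype).codRestrict (sl11 k) fun A => matComp_mem i A

/-- The superbracket of `sl(1|1)`. -/
def bracket {k : Type u} [Field k] (A B : sl11 k) : sl11 k :=
  ⟨matBracket A.1 B.1, matBracket_mem A.1 B.1⟩

/-- The homogeneous part of parity `i` of `sl(1|1)`: the diagonal matrices for `i = 0`,
the off-diagonal ones for `i = 1`. -/
def part (k : Type u) [Field k] (i : ZMod 2) : Submodule k (sl11 k) where
  carrier := {A | comp i A = A}
  add_mem' {A B} hA hB := by
    simp only [Set.mem_ofPred_eq] at *
    rw [map_add, hA, hB]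
  zero_mem' := by simp
  smul_mem' c A hA := by
    simp only [Set.mem_ofPred_eq] at *
    rw [map_smul, hA]

/-- A supermodule over the Lie superalgebra `sl(1|1)`. -/
structure SuperModule (k : Type u) [Field k] where
  carrier : Type u
  [addCommGroup : AddCommGroup carrier]
  [module : Module k carrier]
  /-- `gr 0` is the even part and `gr 1` the odd part. -/
  gr : ZMod 2 → Submodule k carrier
  isCompl_gr : IsCompl (gr 0) (gr 1)
  /-- The action of `sl(1|1)`. -/
  act : sl11 k →ₗ[k] Module.End k carrier
  act_mem : ∀ (i j : ZMod 2) (A : sl11 k) (m : carrier),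
    A ∈ part k i → m ∈ gr j → act A m ∈ gr (i + j)
  act_bracket : ∀ (i j : ZMod 2) (A B : sl11 k), A ∈ part k i → B ∈ part k j →
    act (bracket A B) = act A * act B - koszul i j • (act B * act A)

attribute [instance] SuperModule.addCommGroup SuperModule.module

theorem bracket_eq {k : Type u} [Field k] {i j : ZMod 2} {A B : sl11 k}
    (hA : A ∈ part k i) (hB : B ∈ part k j) :
    (bracket A B : Matrix (ZMod 2) (ZMod 2) k) = A.1 * B.1 - koszul i j • (B.1 * A.1) := by
  have key : ∀ (i l : ZMod 2) (A : sl11 k), A ∈ part k i →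
      matComp k l A.1 = if l = i then A.1 else 0 := by
    intro i l A hA
    have h : matComp k i A.1 = A.1 := congrArg Subtype.val hA
    split_ifs with hl
    · rw [hl, h]
    · rw [← h]
      ext a b
      by_cases h1 : a + b = l
      · have h3 : a + b ≠ i := fun h3 => hl (h1 ▸ h3)
        simp [matComp, h3]
      · simp [matComp, h1]
  simp [bracket, matBracket, key i _ A hA, key j _ B hB, Finset.sum_sub_distrib]

theorem comp_of_mem {k : Type u} [Field k] {i : ZMod 2} (l : ZMod 2) {A : sl11 k}
    (hA : A ∈ part k i) : comp l A = if l = i then A else 0 := by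
  have h : comp i A = A := hA
  split_ifs with hl
  · rw [hl, h]
  · rw [← h]
    ext a b
    by_cases h1 : a + b = l
    · have h3 : a + b ≠ i := fun h3 => hl (h1 ▸ h3)
      simp [comp, matComp, h3]
    · simp [comp, matComp, h1]

theorem bracket_mem {k : Type u} [Field k] {i j : ZMod 2} {A B : sl11 k}
    (hA : A ∈ part k i) (hB : B ∈ part k j) : bracket A B ∈ part k (i + j) := by
  have hA' : matComp k i A.1 = A.1 := congrArg Subtype.val hA
  have hB' : matComp k j B.1 = B.1 := congrArg Subtype.val hB
  change comp (i + j) (bracket A B) = bracket A B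
  apply Subtype.ext
  change matComp k (i + j) (bracket A B).1 = (bracket A B).1
  have h : (bracket A B).1 = matComp k i A.1 * matComp k j B.1
      - koszul i j • (matComp k j B.1 * matComp k i A.1) := by
    rw [hA', hB']; exact bracket_eq hA hB
  rw [h]
  have h2 : (1 + 1 : ZMod 2) = 0 := rfl
  ext a b
  rcases parity_cases i with rfl | rfl <;> rcases parity_cases j with rfl | rfl <;>
    rcases parity_cases a with rfl | rfl <;> rcases parity_cases b with rfl | rfl <;>
    simp [matComp, Matrix.mul_apply, univ_eq, h2, koszul, ZMod.val_one]

theorem bracket_offdiag {k : Type u} [Field k] (A B : sl11 k) :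
    (bracket A B).1 0 1 = 0 ∧ (bracket A B).1 1 0 = 0 := by
  have hA : A.1 0 0 - A.1 1 1 = 0 := A.2
  have hB : B.1 0 0 - B.1 1 1 = 0 := B.2
  have h2 : (1 + 1 : ZMod 2) = 0 := rfl
  rw [sub_eq_zero] at hA hB
  constructor <;>
    simp [bracket, matBracket, matComp, koszul, univ_eq, Matrix.mul_apply, ZMod.val_one, h2,
      hA, hB] <;> ring

theorem offdiag_of_mem_zero {k : Type u} [Field k] {A : sl11 k} (hA : A ∈ part k 0) :
    A.1 0 1 = 0 ∧ A.1 1 0 = 0 := by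
  have h : matComp k 0 A.1 = A.1 := congrArg Subtype.val hA
  constructor <;> rw [← h] <;> simp [matComp]

theorem koszul_mul_self (i j : ZMod 2) : koszul i j * koszul i j = 1 := by
  revert i j; decide

theorem koszul_comm (i j : ZMod 2) : koszul i j = koszul j i := by
  revert i j; decide

theorem eq_of_add_zero {j l : ZMod 2} : j + l = 0 → l = j := by
  revert j l; decide

theorem ne_of_add_one {j l : ZMod 2} : j + l = 1 → j ≠ l := by
  revert j l; decide

theorem koszul_add (i j l : ZMod 2) : koszul (i + j) l = koszul i l * koszul j l := by
  revert i j l; decide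

theorem koszul_add_right (i j l : ZMod 2) : koszul l (i + j) = koszul l i * koszul l j := by
  revert i j l; decide

namespace SuperModule

variable {k : Type u} [Field k]

/-- The projection to the homogeneous part of parity `i`. -/
noncomputable def proj (M : SuperModule k) (i : ZMod 2) : Module.End k M.carrier :=
  if i = 0 then (M.gr 0).projection (M.gr 1) M.isCompl_gr
  else (M.gr 1).projection (M.gr 0) M.isCompl_gr.symm

/-- The operator `m ↦ (-1)^(i |m|) m`. -/
noncomputable def twist (M : SuperModule k) (i : ZMod 2) : Module.End k M.carrier :=
  ∑ j : ZMod 2, koszul i j • M.proj j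

theorem proj_of_mem (M : SuperModule k) (i : ZMod 2) {j : ZMod 2} {m : M.carrier}
    (hm : m ∈ M.gr j) : M.proj i m = if i = j then m else 0 := by
  rcases parity_cases i with rfl | rfl <;> rcases parity_cases j with rfl | rfl <;>
    simp [proj, Submodule.projection_apply_of_mem_left, Submodule.projection_apply_of_mem_right, hm]

theorem twist_of_mem (M : SuperModule k) (i : ZMod 2) {j : ZMod 2} {m : M.carrier}
    (hm : m ∈ M.gr j) : M.twist i m = koszul i j • m := by
  simp [twist, proj_of_mem M _ hm]

theorem end_ext (M : SuperModule k) {V : Type u} [AddCommGroup V] [Module k V]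
    {f g : M.carrier →ₗ[k] V} (h : ∀ i, ∀ m ∈ M.gr i, f m = g m) : f = g := by
  ext m
  have hm : m ∈ M.gr 0 ⊔ M.gr 1 := by rw [M.isCompl_gr.sup_eq_top]; trivial
  obtain ⟨a, ha, b, hb, rfl⟩ := Submodule.mem_sup.1 hm
  rw [map_add, map_add, h 0 a ha, h 1 b hb]

theorem twist_mul_twist (M : SuperModule k) (i j : ZMod 2) :
    M.twist i * M.twist j = M.twist (i + j) := by
  refine M.end_ext fun l m hm => ?_
  rw [Module.End.mul_apply, twist_of_mem M j hm, map_zsmul, twist_of_mem M i hm,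
    twist_of_mem M _ hm, smul_smul, koszul_add, mul_comm]

theorem twist_mul_act (M : SuperModule k) (i : ZMod 2) {j : ZMod 2} {A : sl11 k}
    (hA : A ∈ part k j) : M.twist i * M.act A = koszul i j • (M.act A * M.twist i) := by
  refine M.end_ext fun l m hm => ?_
  rw [Module.End.mul_apply, LinearMap.smul_apply, Module.End.mul_apply, twist_of_mem M i hm,
    map_zsmul, twist_of_mem M i (M.act_mem j l A m hA hm), smul_smul, koszul_add_right]

/-- A homomorphism of supermodules: an even linear map commuting with the action. -/
structure Hom (M N : SuperModule k) where
  toLin : M.carrier →ₗ[k] N.carrier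
  map_gr : ∀ i, ∀ m ∈ M.gr i, toLin m ∈ N.gr i
  map_act : ∀ (A : sl11 k) (m : M.carrier), toLin (M.act A m) = N.act A (toLin m)

/-- Two supermodules are isomorphic if there is a bijective (even) homomorphism between them. -/
def IsIso (M N : SuperModule k) : Prop :=
  ∃ f : Hom M N, Function.Bijective f.toLin

/-- The category `F`: finite dimensional supermodules which are completely reducible over the
even part of `sl(1|1)`, that is, every invariant subspace has an invariant complement. -/
def InF (M : SuperModule k) : Prop :=
  FiniteDimensional k M.carrier ∧
    ∀ N : Submodule k M.carrier, (∀ A ∈ part k 0, ∀ m ∈ N, M.act A m ∈ N) →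
      ∃ N' : Submodule k M.carrier, (∀ A ∈ part k 0, ∀ m ∈ N', M.act A m ∈ N') ∧ IsCompl N N'

/-- Projective objects of the category `F`. -/
def IsProjective (P : SuperModule k) : Prop :=
  P.InF ∧ ∀ M N : SuperModule k, M.InF → N.InF →
    ∀ (g : Hom M N) (f : Hom P N), Function.Surjective g.toLin →
      ∃ h : Hom P M, ∀ m, g.toLin (h.toLin m) = f.toLin m

/-- Subsupermodules: graded subspaces that are stable under the action. -/
def IsSub (M : SuperModule k) (N : Submodule k M.carrier) : Prop :=
  N = (N ⊓ M.gr 0) ⊔ (N ⊓ M.gr 1) ∧ ∀ (A : sl11 k), ∀ m ∈ N, M.act A m ∈ N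

/-- A supermodule is indecomposable if it is nonzero and not the direct sum of two nonzero
subsupermodules. -/
def Indecomposable (M : SuperModule k) : Prop :=
  Nontrivial M.carrier ∧ ∀ N N' : Submodule k M.carrier,
    M.IsSub N → M.IsSub N' → IsCompl N N' → N = ⊥ ∨ N' = ⊥

/-- The Jordan type of `M` at the odd element `z` is `a₁[1] + a₂[2]`: the restriction of `M` to
the subsuperalgebra generated by `z` is the direct sum of `a₁` one-dimensional trivial modules
(each even or odd) and `a₂` copies of `k[z]/z^2` (up to parity change). The basis consists of
generators of the trivial summands and of a pair `(w, z w)` for each of the other summands. -/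
def HasJordanTypeAt (M : SuperModule k) (z : sl11 k) (a₁ a₂ : ℕ) : Prop :=
  ∃ b : Module.Basis (Fin a₁ ⊕ (Fin a₂ ⊕ Fin a₂)) k M.carrier,
    (∀ i, b i ∈ M.gr 0 ∨ b i ∈ M.gr 1) ∧
    (∀ i, M.act z (b (Sum.inl i)) = 0) ∧
    (∀ j, M.act z (b (Sum.inr (Sum.inl j))) = b (Sum.inr (Sum.inr j))) ∧
    (∀ j, M.act z (b (Sum.inr (Sum.inr j))) = 0)

/-- Strong constant Jordan type `a₁[1] + a₂[2]`: the Jordan type is `a₁[1] + a₂[2]` at every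
nonzero odd element. -/
def HasStrongConstantJordanType (M : SuperModule k) (a₁ a₂ : ℕ) : Prop :=
  ∀ z ∈ part k 1, z ≠ 0 → M.HasJordanTypeAt z a₁ a₂

/-- The parity change functor on objects. -/
def parityChange (M : SuperModule k) : SuperModule k where
  carrier := M.carrier
  gr i := M.gr (i + 1)
  isCompl_gr := M.isCompl_gr.symm
  act := M.act
  act_mem i j A m hA hm := by
    rw [add_assoc]; exact M.act_mem i (j + 1) A m hA hm
  act_bracket := M.act_bracket

/-- The direct sum. -/
def directSum (M N : SuperModule k) : SuperModule k where
  carrier := M.carrier × N.carrier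
  gr i := (M.gr i).prod (N.gr i)
  isCompl_gr := by
    constructor
    · rw [disjoint_iff, Submodule.prod_inf_prod, M.isCompl_gr.inf_eq_bot,
        N.isCompl_gr.inf_eq_bot, Submodule.prod_bot]
    · rw [codisjoint_iff, Submodule.prod_sup_prod, M.isCompl_gr.sup_eq_top,
        N.isCompl_gr.sup_eq_top, Submodule.prod_top]
  act :=
    { toFun := fun A => (M.act A).prodMap (N.act A)
      map_add' := fun A B => by ext <;> simp
      map_smul' := fun c A => by ext <;> simp }
  act_mem i j A m hA hm := ⟨M.act_mem i j A m.1 hA hm.1, N.act_mem i j A m.2 hA hm.2⟩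
  act_bracket i j A B hA hB := by
    ext <;> simp [M.act_bracket i j A B hA hB, N.act_bracket i j A B hA hB]

/-- The trivial one-dimensional supermodule concentrated in even degree. -/
def trivialEven (k : Type u) [Field k] : SuperModule k where
  carrier := k
  gr i := if i = 0 then ⊤ else ⊥
  isCompl_gr := by simpa using isCompl_top_bot
  act := 0
  act_mem i j A m _ _ := by simp
  act_bracket i j A B _ _ := by simp

theorem act_mul_twist (M : SuperModule k) (i : ZMod 2) {j : ZMod 2} {A : sl11 k}
    (hA : A ∈ part k j) : M.act A * M.twist i = koszul i j • (M.twist i * M.act A) := by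
  rw [M.twist_mul_act i hA, smul_smul, koszul_mul_self, one_smul]

/-- The action on the dual: `(A φ) m = - (-1)^(|A| |φ|) φ (A m)`. -/
noncomputable def dualAct (M : SuperModule k) :
    sl11 k →ₗ[k] Module.End k (Module.Dual k M.carrier) where
  toFun A := - ∑ i : ZMod 2, Module.Dual.transpose (R := k) (M.twist i * M.act (comp i A))
  map_add' A B := by
    simp only [map_add, mul_add, Finset.sum_add_distrib]; abel
  map_smul' c A := by
    simp only [map_smul, mul_smul_comm, RingHom.id_apply, ← Finset.smul_sum]
    exact (smul_neg c (∑ i : ZMod 2, (Module.Dual.transpose (R := k)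
      (M.twist i * M.act (comp i A)) : Module.End k (Module.Dual k M.carrier)))).symm

theorem dualAct_apply (M : SuperModule k) {i : ZMod 2} {A : sl11 k} (hA : A ∈ part k i)
    (φ : Module.Dual k M.carrier) (m : M.carrier) :
    M.dualAct A φ m = - φ (M.twist i (M.act A m)) := by
  have h : ∀ l, M.twist l * M.act (comp l A) = if l = i then M.twist l * M.act A else 0 := by
    intro l
    rw [comp_of_mem l hA]
    split_ifs <;> simp
  change (- ∑ l : ZMod 2, Module.Dual.transpose (R := k) (M.twist l * M.act (comp l A))) φ m = _
  rw [Finset.sum_eq_single i]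
  · rw [h, if_pos rfl]; rfl
  · intro l _ hl
    rw [h, if_neg hl, map_zero]
  · simp

theorem parity_aux (i j : ZMod 2) : i + (i + j + 1) = j + 1 := by
  revert i j; decide

/-- The dual supermodule. A linear form is even if it vanishes on the odd part and odd if it
vanishes on the even part. -/
noncomputable def dual (M : SuperModule k) : SuperModule k where
  carrier := Module.Dual k M.carrier
  gr i := (M.gr (i + 1)).dualAnnihilator
  isCompl_gr := Subspace.isCompl_dualAnnihilator M.isCompl_gr.symm
  act := M.dualAct
  act_mem i j A φ hA hφ := by
    rw [Submodule.mem_dualAnnihilator] at hφ ⊢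
    intro m hm
    have hp := M.act_mem i _ A m hA hm
    rw [dualAct_apply M hA, twist_of_mem M i hp, map_zsmul, hφ, smul_zero, neg_zero]
    rw [parity_aux] at hp
    exact hp
  act_bracket i j A B hA hB := by
    refine LinearMap.ext fun φ => LinearMap.ext fun m => ?_
    have e : M.twist j * M.act B * (M.twist i * M.act A)
        - koszul i j • (M.twist i * M.act A * (M.twist j * M.act B))
        = - (M.twist (i + j) * M.act (bracket A B)) := by
      rw [M.act_bracket i j A B hA hB, mul_assoc, ← mul_assoc (M.act B), act_mul_twist M i hB,
        mul_assoc (M.twist i), ← mul_assoc (M.act A) (M.twist j), act_mul_twist M j hA]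
      have hk : koszul j i = koszul i j := koszul_comm j i
      simp only [hk, smul_mul_assoc, mul_smul_comm, smul_smul, koszul_mul_self, one_smul, mul_sub,
        ← mul_assoc, twist_mul_twist, add_comm j i]
      abel
    have e' := congrArg φ (LinearMap.congr_fun e m)
    simp only [LinearMap.sub_apply, LinearMap.smul_apply, LinearMap.neg_apply,
      Module.End.mul_apply, map_sub, map_neg, map_zsmul] at e'
    simp only [LinearMap.sub_apply, LinearMap.smul_apply, Module.End.mul_apply,
      dualAct_apply M hA, dualAct_apply M hB, dualAct_apply M (bracket_mem hA hB), neg_neg]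
    exact e'.symm

/-- The action on the tensor product: `A (m ⊗ n) = A m ⊗ n + (-1)^(|A| |m|) m ⊗ A n`. -/
noncomputable def tensorAct (M N : SuperModule k) :
    sl11 k →ₗ[k] Module.End k (M.carrier ⊗[k] N.carrier) where
  toFun A := TensorProduct.map (M.act A) LinearMap.id +
    ∑ i : ZMod 2, TensorProduct.map (M.twist i) (N.act (comp i A))
  map_add' A B := by
    simp only [map_add, TensorProduct.map_add_left, TensorProduct.map_add_right,
      Finset.sum_add_distrib]; abel
  map_smul' c A := by
    simp only [map_smul, TensorProduct.map_smul_left, TensorProduct.map_smul_right,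
      RingHom.id_apply, smul_add, Finset.smul_sum]

theorem tensorAct_tmul (M N : SuperModule k) {i : ZMod 2} {A : sl11 k} (hA : A ∈ part k i)
    (m : M.carrier) (n : N.carrier) :
    M.tensorAct N A (m ⊗ₜ n) = M.act A m ⊗ₜ n + M.twist i m ⊗ₜ N.act A n := by
  have h : ∀ l, TensorProduct.map (M.twist l) (N.act (comp l A)) =
      if l = i then TensorProduct.map (M.twist l) (N.act A) else 0 := by
    intro l
    rw [comp_of_mem l hA]
    split_ifs <;> simp
  simp [tensorAct, h]

/-- The homogeneous parts of the tensor product: the part of parity `i` is spanned by the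
`m ⊗ n` with `m` and `n` homogeneous and `|m| + |n| = i`. -/
def tensorGr (M N : SuperModule k) (i : ZMod 2) : Submodule k (M.carrier ⊗[k] N.carrier) :=
  Submodule.span k {t | ∃ j l : ZMod 2, j + l = i ∧ ∃ m ∈ M.gr j, ∃ n ∈ N.gr l, t = m ⊗ₜ n}

theorem tmul_mem_tensorGr (M N : SuperModule k) {j l : ZMod 2} {m : M.carrier} {n : N.carrier}
    (hm : m ∈ M.gr j) (hn : n ∈ N.gr l) : m ⊗ₜ n ∈ M.tensorGr N (j + l) :=
  Submodule.subset_span ⟨j, l, rfl, m, hm, n, hn, rfl⟩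

theorem tensor_isCompl (M N : SuperModule k) : IsCompl (M.tensorGr N 0) (M.tensorGr N 1) := by
  constructor
  · let Q : Module.End k (M.carrier ⊗[k] N.carrier) :=
      ∑ j : ZMod 2, TensorProduct.map (M.proj j) (N.proj j)
    have h0 : ∀ t ∈ M.tensorGr N 0, Q t = t := by
      intro t ht
      induction ht using Submodule.span_induction with
      | mem t ht =>
        obtain ⟨j, l, hjl, m, hm, n, hn, rfl⟩ := ht
        have : l = j := eq_of_add_zero hjl
        subst this
        simp [Q, proj_of_mem M _ hm, proj_of_mem N _ hn, TensorProduct.ite_tmul]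
      | zero => simp
      | add x y _ _ hx hy => rw [map_add, hx, hy]
      | smul c x _ hx => rw [map_smul, hx]
    have h1 : ∀ t ∈ M.tensorGr N 1, Q t = 0 := by
      intro t ht
      induction ht using Submodule.span_induction with
      | mem t ht =>
        obtain ⟨j, l, hjl, m, hm, n, hn, rfl⟩ := ht
        have : j ≠ l := ne_of_add_one hjl
        simp [Q, proj_of_mem M _ hm, proj_of_mem N _ hn, TensorProduct.ite_tmul, this]
      | zero => simp
      | add x y _ _ hx hy => rw [map_add, hx, hy, add_zero]
      | smul c x _ hx => rw [map_smul, hx, smul_zero]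
    rw [Submodule.disjoint_def]
    intro t ht0 ht1
    rw [← h0 t ht0, h1 t ht1]
  · rw [codisjoint_iff, eq_top_iff]
    intro t _
    have hs : ∀ (j l : ZMod 2) (m : M.carrier) (n : N.carrier), m ∈ M.gr j → n ∈ N.gr l →
        m ⊗ₜ n ∈ M.tensorGr N 0 ⊔ M.tensorGr N 1 := by
      intro j l m n hm hn
      have h := tmul_mem_tensorGr M N hm hn
      rcases parity_cases (j + l) with h' | h' <;> rw [h'] at h
      · exact Submodule.mem_sup_left h
      · exact Submodule.mem_sup_right h
    induction t using TensorProduct.induction_on with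
    | zero => exact Submodule.zero_mem _
    | tmul m n =>
      have hm : m ∈ M.gr 0 ⊔ M.gr 1 := by rw [M.isCompl_gr.sup_eq_top]; trivial
      have hn : n ∈ N.gr 0 ⊔ N.gr 1 := by rw [N.isCompl_gr.sup_eq_top]; trivial
      obtain ⟨a, ha, b, hb, rfl⟩ := Submodule.mem_sup.1 hm
      obtain ⟨c, hc, d, hd, rfl⟩ := Submodule.mem_sup.1 hn
      rw [TensorProduct.add_tmul, TensorProduct.tmul_add, TensorProduct.tmul_add]
      exact add_mem (add_mem (hs _ _ _ _ ha hc) (hs _ _ _ _ ha hd))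
        (add_mem (hs _ _ _ _ hb hc) (hs _ _ _ _ hb hd))
    | add x y hx hy => exact add_mem (hx trivial) (hy trivial)

/-- The tensor product of supermodules. -/
noncomputable def tensor (M N : SuperModule k) : SuperModule k where
  carrier := M.carrier ⊗[k] N.carrier
  gr := M.tensorGr N
  isCompl_gr := tensor_isCompl M N
  act := M.tensorAct N
  act_mem i j A t hA ht := by
    induction ht using Submodule.span_induction with
    | mem t ht =>
      obtain ⟨p, q, hpq, m, hm, n, hn, rfl⟩ := ht
      subst hpq
      rw [tensorAct_tmul M N hA, twist_of_mem M i hm]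
      refine add_mem ?_ ?_
      · rw [← add_assoc]
        exact tmul_mem_tensorGr M N (M.act_mem i p A m hA hm) hn
      · rw [add_left_comm]
        exact tmul_mem_tensorGr M N (zsmul_mem hm _) (N.act_mem i q A n hA hn)
    | zero => rw [map_zero]; exact Submodule.zero_mem _
    | add x y _ _ hx hy => rw [map_add]; exact add_mem hx hy
    | smul c x _ hx => rw [map_smul]; exact Submodule.smul_mem _ _ hx
  act_bracket i j A B hA hB := by
    refine TensorProduct.ext' fun m n => ?_
    have e1 := LinearMap.congr_fun (M.act_mul_twist j hA) m
    have e2 := LinearMap.congr_fun (M.twist_mul_act i hB) m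
    have e3 := LinearMap.congr_fun (M.twist_mul_twist i j) m
    have e4 := LinearMap.congr_fun (M.twist_mul_twist j i) m
    have hk : koszul j i = koszul i j := koszul_comm j i
    simp only [Module.End.mul_apply, LinearMap.smul_apply] at e1 e2 e3 e4
    simp only [LinearMap.sub_apply, LinearMap.smul_apply, Module.End.mul_apply,
      tensorAct_tmul M N hA, tensorAct_tmul M N hB, tensorAct_tmul M N (bracket_mem hA hB),
      map_add, e1, e2, e3, e4, M.act_bracket i j A B hA hB, N.act_bracket i j A B hA hB, hk,
      add_comm j i, TensorProduct.tmul_sub, TensorProduct.sub_tmul, TensorProduct.tmul_smul,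
      smul_add, TensorProduct.smul_tmul']
    abel

/-- `M` is endotrivial if `M ⊗ M*` is isomorphic to the direct sum of the even trivial module and
a projective object of `F`. -/
def IsEndotrivial (M : SuperModule k) : Prop :=
  ∃ P : SuperModule k, P.IsProjective ∧ (M.tensor M.dual).IsIso ((trivialEven k).directSum P)

/-- The action of `sl(1|1)` on `W_{n,2}`, see below. -/
def WAct (k : Type u) [Field k] (n : ℕ) :
    sl11 k →ₗ[k] Module.End k ((Fin n → k) × (Fin (n - 1) → k)) :=
  LinearMap.mk₂ k
    (fun A v => (0, fun j => A.1 0 1 * v.1 ⟨j.1 + 1, by omega⟩ + A.1 1 0 * v.1 ⟨j.1, by omega⟩))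
    (fun A B v => by
      refine Prod.ext (by simp) (funext fun j => ?_)
      simp only [Submodule.coe_add, Matrix.add_apply, Prod.snd_add, Pi.add_apply]; ring)
    (fun c A v => by
      refine Prod.ext (by simp) (funext fun j => ?_)
      simp only [Submodule.coe_smul, Matrix.smul_apply, Prod.smul_snd, Pi.smul_apply,
        smul_eq_mul]; ring)
    (fun A v w => by
      refine Prod.ext (by simp) (funext fun j => ?_)
      simp only [Prod.fst_add, Prod.snd_add, Pi.add_apply]; ring)
    (fun c A v => by
      refine Prod.ext (by simp) (funext fun j => ?_)
      simp only [Prod.smul_fst, Prod.smul_snd, Pi.smul_apply, smul_eq_mul]; ring)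

/-- The module `W_{n,2}`: it has an even basis `v 0, ..., v (n-1)` and an odd basis
`w 0, ..., w (n-2)`, and for `x = E₀₁`, `y = E₁₀` the action is
`x (v 0) = 0`, `x (v (i+1)) = w i = y (v i)`, `y (v (n-1)) = 0`, and `x`, `y` kill every `w i`;
the even part of `sl(1|1)` acts as zero. A pair `(f, g)` below is `∑ f i • v i + ∑ g i • w i`. -/
def W (k : Type u) [Field k] (n : ℕ) : SuperModule k where
  carrier := (Fin n → k) × (Fin (n - 1) → k)
  gr i := if i = 0 then Submodule.prod ⊤ ⊥ else Submodule.prod ⊥ ⊤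
  isCompl_gr := by
    constructor
    · simp [disjoint_iff, Submodule.prod_inf_prod]
    · simp [codisjoint_iff, Submodule.prod_sup_prod]
  act := WAct k n
  act_mem i j A m hA hm := by
    have h2 : (1 + 1 : ZMod 2) = 0 := rfl
    rcases parity_cases i with rfl | rfl
    · have h := offdiag_of_mem_zero hA
      have h3 : WAct k n A m = 0 := by ext l <;> simp [WAct, h.1, h.2]
      rw [h3]
      exact Submodule.zero_mem _
    · rcases parity_cases j with rfl | rfl
      · simp [Submodule.mem_prod, WAct]
      · have hm1 : m.1 = 0 := by simpa [Submodule.mem_prod] using hm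
        have h3 : WAct k n A m = 0 := by ext l <;> simp [WAct, hm1]
        rw [h3]
        exact Submodule.zero_mem _
  act_bracket i j A B hA hB := by
    refine LinearMap.ext fun v => ?_
    have h := bracket_offdiag A B
    ext l <;> simp [WAct, h.1, h.2]

end SuperModule

end SL11

/-!
Let `X`, `Y` and `T` be the operators by which `x`, `y` and `t` act on `M`. The Jordan type at
`x + y` forces `T = (X + Y) ^ 2 = 0`, so that `M` is a graded module over the exterior algebra on
`x` and `y`.

*The radical squared vanishes.* A supermodule killed by `t` is projective in `F` as soon as it is
free over this exterior algebra, because taking `t`-invariants is exact on `F`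
(`isProjective_of_ker_le_rad`). If `X Y ≠ 0`, a free supermodule of rank one splits off from `M`, so
that an indecomposable `M` would be projective (`Indecomposable.X_Y_eq_zero`). Hence `X Y = 0`, and
then `X` and `Y` vanish on one homogeneous part and map the other one, `V`, to it
(`Indecomposable.exists_parity`). Up to parity, `M` is a pencil of linear maps `X, Y : V → W`.

*The classification.* By hypothesis all members `a X + b Y` of this pencil have the same rank. If
`dim W ≤ dim V`, then no member is injective: for `dim V = dim W` some member is singular, since
the field is algebraically closed, and so all are (`exists_ker_of_constant_rank`). Kronecker's
argument splits off a minimal pencil (`exists_retraction_of_forall_not_injective`), which is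
`W_{n,2}`, and `M` is isomorphic to it by indecomposability. If `dim V < dim W`, the same applies to
the dual of `M`, and retractions can be dualised (`IsRetract.of_dual`). The ranks of `x` on
`W_{n,2}` and on its dual give `a₁ = 1`.

*Endotriviality.* `M ⊗ M*` is the space of endomorphisms of `M`, on which an odd `z` acts by the
supercommutator. The Jordan type `[1] + a₂[2]` provides a contracting homotopy for `z` up to a
projection of rank one. It follows that the superdimension is `1` or `-1`, so that the identity
spans a complement of the space `Q` of endomorphisms of supertrace zero, and that `Q` is exact at
every nonzero odd `z`. An analogue of Dade's lemma (`isProjective_of_exact`) shows that such a `Q`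
is free over the exterior algebra, hence projective.
-/

namespace SL11

open scoped TensorProduct

/-! ### The standard basis of `sl(1|1)` -/

/-- The even basis vector `t` of `sl(1|1)`: the identity matrix. -/
def t (k : Type u) [Field k] : sl11 k := ⟨1, by simp [supertrace]⟩

/-- The odd basis vector `x = E₀₁` of `sl(1|1)`. -/
def x (k : Type u) [Field k] : sl11 k := ⟨Matrix.single 0 1 1, by simp [supertrace]⟩

/-- The odd basis vector `y = E₁₀` of `sl(1|1)`. -/
def y (k : Type u) [Field k] : sl11 k := ⟨Matrix.single 1 0 1, by simp [supertrace]⟩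

section Basis
variable {k : Type u} [Field k]

theorem eq_smul_t_add_smul_x_add_smul_y (A : sl11 k) :
    A = A.1 0 0 • t k + A.1 0 1 • x k + A.1 1 0 • y k := by
  have hA : A.1 0 0 - A.1 1 1 = 0 := A.2
  apply Subtype.ext
  ext a b
  rcases parity_cases a with rfl | rfl <;> rcases parity_cases b with rfl | rfl <;>
    simp [t, x, y, (sub_eq_zero.1 hA)]

theorem t_mem_part : t k ∈ part k 0 := by
  change comp 0 (t k) = t k
  apply Subtype.ext
  ext a b
  rcases parity_cases a with rfl | rfl <;> rcases parity_cases b with rfl | rfl <;>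
    simp [comp, matComp, t]
  rfl

theorem x_mem_part : x k ∈ part k 1 := by
  change comp 1 (x k) = x k
  apply Subtype.ext
  ext a b
  rcases parity_cases a with rfl | rfl <;> rcases parity_cases b with rfl | rfl <;>
    simp [comp, matComp, x]

theorem y_mem_part : y k ∈ part k 1 := by
  change comp 1 (y k) = y k
  apply Subtype.ext
  ext a b
  rcases parity_cases a with rfl | rfl <;> rcases parity_cases b with rfl | rfl <;>
    simp [comp, matComp, y]

theorem exists_eq_smul_t {A : sl11 k} (hA : A ∈ part k 0) : ∃ c : k, A = c • t k := by
  obtain ⟨h1, h2⟩ := offdiag_of_mem_zero hA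
  refine ⟨A.1 0 0, ?_⟩
  conv_lhs => rw [eq_smul_t_add_smul_x_add_smul_y A, h1, h2]
  simp

theorem smul_x_add_smul_y_mem_part (a b : k) : a • x k + b • y k ∈ part k 1 :=
  add_mem (Submodule.smul_mem _ _ x_mem_part) (Submodule.smul_mem _ _ y_mem_part)

theorem smul_x_add_smul_y_ne_zero {a b : k} (h : a ≠ 0 ∨ b ≠ 0) : a • x k + b • y k ≠ 0 := by
  intro h0
  have h1 := congrArg (fun A : sl11 k => A.1 0 1) h0
  have h2 := congrArg (fun A : sl11 k => A.1 1 0) h0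
  simp [x, y] at h1 h2
  tauto

theorem bracket_x_x : bracket (x k) (x k) = 0 := by
  apply Subtype.ext
  rw [bracket_eq x_mem_part x_mem_part]
  ext a b
  rcases parity_cases a with rfl | rfl <;> rcases parity_cases b with rfl | rfl <;>
    simp [x]

theorem bracket_y_y : bracket (y k) (y k) = 0 := by
  apply Subtype.ext
  rw [bracket_eq y_mem_part y_mem_part]
  ext a b
  rcases parity_cases a with rfl | rfl <;> rcases parity_cases b with rfl | rfl <;>
    simp [y]

theorem koszul_one_one : koszul 1 1 = -1 := by decide

theorem bracket_x_y : bracket (x k) (y k) = t k := by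
  apply Subtype.ext
  rw [bracket_eq x_mem_part y_mem_part]
  ext a b
  rcases parity_cases a with rfl | rfl <;> rcases parity_cases b with rfl | rfl <;>
    simp [x, y, t, koszul_one_one]

theorem bracket_t {i : ZMod 2} {A : sl11 k} (hA : A ∈ part k i) : bracket (t k) A = 0 := by
  apply Subtype.ext
  rw [bracket_eq t_mem_part hA]
  simp [t, koszul]

end Basis

namespace SuperModule
variable {k : Type u} [Field k]

/-! ### Supermodules as representations of `x`, `y` and `t` -/

/-- The operator by which `x` acts. -/
def X (M : SuperModule k) : Module.End k M.carrier := M.act (x k)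

/-- The operator by which `y` acts. -/
def Y (M : SuperModule k) : Module.End k M.carrier := M.act (y k)

/-- The operator by which `t` acts. -/
def T (M : SuperModule k) : Module.End k M.carrier := M.act (t k)

theorem act_eq (M : SuperModule k) (A : sl11 k) :
    M.act A = A.1 0 0 • M.T + A.1 0 1 • M.X + A.1 1 0 • M.Y := by
  conv_lhs => rw [eq_smul_t_add_smul_x_add_smul_y A]
  simp [T, X, Y]

theorem act_apply (M : SuperModule k) (A : sl11 k) (m : M.carrier) :
    M.act A m = A.1 0 0 • M.T m + A.1 0 1 • M.X m + A.1 1 0 • M.Y m := by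
  rw [act_eq]; rfl

theorem act_odd (M : SuperModule k) (a b : k) (m : M.carrier) :
    M.act (a • x k + b • y k) m = a • M.X m + b • M.Y m := by
  simp [X, Y]

theorem act_even (M : SuperModule k) (hT : M.T = 0) {A : sl11 k} (hA : A ∈ part k 0) :
    M.act A = 0 := by
  obtain ⟨c, rfl⟩ := exists_eq_smul_t hA
  rw [map_smul]
  change c • M.T = 0
  rw [hT, smul_zero]

theorem X_mem (M : SuperModule k) {j : ZMod 2} {m : M.carrier} (hm : m ∈ M.gr j) :
    M.X m ∈ M.gr (j + 1) := by
  rw [add_comm]; exact M.act_mem 1 j _ m x_mem_part hm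

theorem Y_mem (M : SuperModule k) {j : ZMod 2} {m : M.carrier} (hm : m ∈ M.gr j) :
    M.Y m ∈ M.gr (j + 1) := by
  rw [add_comm]; exact M.act_mem 1 j _ m y_mem_part hm

theorem T_mem (M : SuperModule k) {j : ZMod 2} {m : M.carrier} (hm : m ∈ M.gr j) :
    M.T m ∈ M.gr j := by
  have h := M.act_mem 0 j _ m t_mem_part hm
  rwa [zero_add] at h

theorem X_X [CharZero k] (M : SuperModule k) (m : M.carrier) : M.X (M.X m) = 0 := by
  have h := M.act_bracket 1 1 _ _ x_mem_part x_mem_part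
  rw [bracket_x_x, koszul_one_one] at h
  have h' := LinearMap.congr_fun h m
  simp only [map_zero, LinearMap.zero_apply, neg_smul, one_smul, sub_neg_eq_add,
    ← two_smul k] at h'
  exact (smul_eq_zero.1 h'.symm).resolve_left two_ne_zero

theorem Y_Y [CharZero k] (M : SuperModule k) (m : M.carrier) : M.Y (M.Y m) = 0 := by
  have h := M.act_bracket 1 1 _ _ y_mem_part y_mem_part
  rw [bracket_y_y, koszul_one_one] at h
  have h' := LinearMap.congr_fun h m
  simp only [map_zero, LinearMap.zero_apply, neg_smul, one_smul, sub_neg_eq_add,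
    ← two_smul k] at h'
  exact (smul_eq_zero.1 h'.symm).resolve_left two_ne_zero

theorem Y_X_eq (M : SuperModule k) (m : M.carrier) : M.Y (M.X m) = M.T m - M.X (M.Y m) := by
  have h := M.act_bracket 1 1 _ _ x_mem_part y_mem_part
  rw [bracket_x_y, koszul_one_one] at h
  have h' := LinearMap.congr_fun h m
  simp only [neg_smul, one_smul,
    sub_neg_eq_add, LinearMap.add_apply, Module.End.mul_apply] at h'
  change M.T m = M.X (M.Y m) + M.Y (M.X m) at h'
  rw [h']; abel

theorem T_X (M : SuperModule k) (m : M.carrier) : M.T (M.X m) = M.X (M.T m) := by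
  have h := M.act_bracket 0 1 _ _ t_mem_part x_mem_part
  rw [bracket_t x_mem_part] at h
  have h' := LinearMap.congr_fun h m
  simp only [map_zero, LinearMap.zero_apply, LinearMap.sub_apply, koszul, ZMod.val_zero,
    zero_mul, pow_zero, one_smul, Module.End.mul_apply] at h'
  exact (sub_eq_zero.1 h'.symm)

theorem T_Y (M : SuperModule k) (m : M.carrier) : M.T (M.Y m) = M.Y (M.T m) := by
  have h := M.act_bracket 0 1 _ _ t_mem_part y_mem_part
  rw [bracket_t y_mem_part] at h
  have h' := LinearMap.congr_fun h m
  simp only [map_zero, LinearMap.zero_apply, LinearMap.sub_apply, koszul, ZMod.val_zero,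
    zero_mul, pow_zero, one_smul, Module.End.mul_apply] at h'
  exact (sub_eq_zero.1 h'.symm)

theorem Y_X (M : SuperModule k) (hT : M.T = 0) (m : M.carrier) :
    M.Y (M.X m) = - M.X (M.Y m) := by
  rw [Y_X_eq, hT, LinearMap.zero_apply, zero_sub]

/-! ### The parity projections -/

theorem proj_mem (M : SuperModule k) (i : ZMod 2) (m : M.carrier) : M.proj i m ∈ M.gr i := by
  rcases parity_cases i with rfl | rfl <;> simp [proj]

theorem proj_add_proj (M : SuperModule k) (m : M.carrier) : M.proj 0 m + M.proj 1 m = m := by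
  have h : M.proj 0 + M.proj 1 = LinearMap.id := by
    refine M.end_ext fun i m hm => ?_
    rw [LinearMap.add_apply, proj_of_mem M 0 hm, proj_of_mem M 1 hm]
    rcases parity_cases i with rfl | rfl <;> simp
  exact LinearMap.congr_fun h m

theorem add_one_add_one (i : ZMod 2) : i + 1 + 1 = i := by revert i; decide

theorem proj_odd (M : SuperModule k) {f : Module.End k M.carrier}
    (hf : ∀ j, ∀ m ∈ M.gr j, f m ∈ M.gr (j + 1)) (i : ZMod 2) (m : M.carrier) :
    M.proj i (f m) = f (M.proj (i + 1) m) := by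
  have h : M.proj i ∘ₗ f = f ∘ₗ M.proj (i + 1) := by
    refine M.end_ext fun j m hm => ?_
    rw [LinearMap.comp_apply, LinearMap.comp_apply, proj_of_mem M i (hf j m hm),
      proj_of_mem M (i + 1) hm]
    have : i = j + 1 ↔ i + 1 = j := by clear hm; revert i j; decide
    simp only [this]
    split_ifs <;> simp
  exact LinearMap.congr_fun h m

theorem proj_X (M : SuperModule k) (i : ZMod 2) (m : M.carrier) :
    M.proj i (M.X m) = M.X (M.proj (i + 1) m) := M.proj_odd (fun _ _ => M.X_mem) i m

theorem proj_Y (M : SuperModule k) (i : ZMod 2) (m : M.carrier) :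
    M.proj i (M.Y m) = M.Y (M.proj (i + 1) m) := M.proj_odd (fun _ _ => M.Y_mem) i m

theorem map_proj {M N : SuperModule k} {f : M.carrier →ₗ[k] N.carrier}
    (hf : ∀ i, ∀ m ∈ M.gr i, f m ∈ N.gr i) (i : ZMod 2) (m : M.carrier) :
    f (M.proj i m) = N.proj i (f m) := by
  have h : f ∘ₗ M.proj i = N.proj i ∘ₗ f := by
    refine M.end_ext fun j m hm => ?_
    rw [LinearMap.comp_apply, LinearMap.comp_apply, proj_of_mem M i hm,
      proj_of_mem N i (hf j m hm)]
    split_ifs <;> simp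
  exact LinearMap.congr_fun h m

theorem map_twist {M N : SuperModule k} {f : M.carrier →ₗ[k] N.carrier}
    (hf : ∀ i, ∀ m ∈ M.gr i, f m ∈ N.gr i) (i : ZMod 2) (m : M.carrier) :
    f (M.twist i m) = N.twist i (f m) := by
  simp [twist, map_proj hf]

theorem mem_gr_of_proj_eq_zero (M : SuperModule k) {i : ZMod 2} {m : M.carrier}
    (h : M.proj (i + 1) m = 0) : m ∈ M.gr i := by
  have h1 := M.proj_add_proj m
  rcases parity_cases i with rfl | rfl
  · rw [zero_add] at h
    rw [h, add_zero] at h1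
    rw [← h1]; exact M.proj_mem 0 m
  · have e : (1 + 1 : ZMod 2) = 0 := rfl
    rw [e] at h
    rw [h, zero_add] at h1
    rw [← h1]; exact M.proj_mem 1 m

theorem twist_zero (M : SuperModule k) : M.twist 0 = 1 := by
  refine M.end_ext fun i m hm => ?_
  rw [twist_of_mem M 0 hm]
  simp [koszul]

theorem twist_twist (M : SuperModule k) (i : ZMod 2) (m : M.carrier) :
    M.twist i (M.twist i m) = m := by
  have h := LinearMap.congr_fun (M.twist_mul_twist i i) m
  have e : i + i = 0 := by clear h; revert i; decide
  rw [e, twist_zero] at h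
  exact h

/-! ### Constructing homomorphisms -/

/-- An even linear map commuting with `x`, `y` and `t` is a homomorphism. -/
def Hom.mk' {M N : SuperModule k} (f : M.carrier →ₗ[k] N.carrier)
    (hgr : ∀ i, ∀ m ∈ M.gr i, f m ∈ N.gr i) (hT : ∀ m, f (M.T m) = N.T (f m))
    (hX : ∀ m, f (M.X m) = N.X (f m)) (hY : ∀ m, f (M.Y m) = N.Y (f m)) : Hom M N where
  toLin := f
  map_gr := hgr
  map_act A m := by
    rw [act_apply, act_apply, map_add, map_add, map_smul, map_smul, map_smul, hT, hX, hY]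

theorem Hom.map_X {M N : SuperModule k} (f : Hom M N) (m : M.carrier) :
    f.toLin (M.X m) = N.X (f.toLin m) := f.map_act _ m

theorem Hom.map_Y {M N : SuperModule k} (f : Hom M N) (m : M.carrier) :
    f.toLin (M.Y m) = N.Y (f.toLin m) := f.map_act _ m

theorem Hom.map_T {M N : SuperModule k} (f : Hom M N) (m : M.carrier) :
    f.toLin (M.T m) = N.T (f.toLin m) := f.map_act _ m

/-- If `t` acts by zero, then every subspace is invariant under the even part, so that complete
reducibility is automatic. -/
theorem inF_of_T_eq_zero (M : SuperModule k) [FiniteDimensional k M.carrier] (hT : M.T = 0) :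
    M.InF := by
  refine ⟨inferInstance, fun N _ => ?_⟩
  obtain ⟨N', hN'⟩ := N.exists_isCompl
  refine ⟨N', fun A hA m _ => ?_, hN'⟩
  rw [act_even M hT hA]
  exact N'.zero_mem

/-! ### A criterion for projectivity -/

/-- In the category `F` the operator `t` is semisimple, so that its kernel has an invariant
complement, on which `t` is injective. -/
theorem InF.T_eq_zero_of_T_T {M : SuperModule k} (hM : M.InF) {m : M.carrier}
    (h : M.T (M.T m) = 0) : M.T m = 0 := by
  obtain ⟨C, hC, hcompl⟩ := hM.2 (LinearMap.ker M.T) (fun A hA v hv => by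
    obtain ⟨c, rfl⟩ := exists_eq_smul_t hA
    rw [LinearMap.mem_ker] at hv ⊢
    rw [map_smul]
    change M.T (c • M.T v) = 0
    rw [hv, smul_zero, map_zero])
  have hm : m ∈ LinearMap.ker M.T ⊔ C := by rw [hcompl.sup_eq_top]; trivial
  obtain ⟨a, ha, c, hc, rfl⟩ := Submodule.mem_sup.1 hm
  rw [LinearMap.mem_ker] at ha
  rw [map_add, ha, zero_add] at h ⊢
  exact Submodule.disjoint_def.1 hcompl.disjoint _ h (hC _ t_mem_part c hc)

theorem InF.exists_ker_add_range {M : SuperModule k} (hM : M.InF) (m : M.carrier) :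
    ∃ c u, M.T c = 0 ∧ m = c + M.T u := by
  obtain ⟨C, hC, hcompl⟩ := hM.2 (LinearMap.range M.T) (fun A hA v hv => by
    obtain ⟨c, rfl⟩ := exists_eq_smul_t hA
    rw [map_smul]
    exact Submodule.smul_mem _ _ ⟨v, rfl⟩)
  have hm : m ∈ LinearMap.range M.T ⊔ C := by rw [hcompl.sup_eq_top]; trivial
  obtain ⟨a, ⟨u, rfl⟩, c, hc, rfl⟩ := Submodule.mem_sup.1 hm
  refine ⟨c, u, ?_, add_comm _ _⟩
  exact Submodule.disjoint_def.1 hcompl.disjoint _ ⟨c, rfl⟩ (hC _ t_mem_part c hc)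

/-- Taking `t`-invariants is exact on the category `F`. -/
theorem InF.exists_lift_ker {M N : SuperModule k} (hM : M.InF) (hN : N.InF) (g : Hom M N)
    (hg : Function.Surjective g.toLin) {n : N.carrier} (hn : N.T n = 0) :
    ∃ c, M.T c = 0 ∧ g.toLin c = n := by
  obtain ⟨m, rfl⟩ := hg n
  obtain ⟨c, v, hc, rfl⟩ := hM.exists_ker_add_range m
  refine ⟨c, hc, ?_⟩
  rw [← g.map_T, map_add, hc, zero_add, g.map_T, g.map_T] at hn
  rw [map_add, g.map_T, hN.T_eq_zero_of_T_T hn, add_zero]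

/-- The subspace `x M + y M`. -/
def rad (M : SuperModule k) : Submodule k M.carrier :=
  LinearMap.range M.X ⊔ LinearMap.range M.Y

theorem mem_rad {M : SuperModule k} {m : M.carrier} :
    m ∈ M.rad ↔ ∃ a b, M.X a + M.Y b = m := by
  simp [rad, Submodule.mem_sup]

theorem X_mem_rad (M : SuperModule k) (m : M.carrier) : M.X m ∈ M.rad :=
  mem_rad.2 ⟨m, 0, by simp⟩

theorem Y_mem_rad (M : SuperModule k) (m : M.carrier) : M.Y m ∈ M.rad :=
  mem_rad.2 ⟨0, m, by simp⟩

/-- The even part of a linear map between supermodules. -/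
noncomputable def evenPart {M N : SuperModule k} (h : M.carrier →ₗ[k] N.carrier) :
    M.carrier →ₗ[k] N.carrier :=
  N.proj 0 ∘ₗ h ∘ₗ M.proj 0 + N.proj 1 ∘ₗ h ∘ₗ M.proj 1

theorem evenPart_apply {M N : SuperModule k} (h : M.carrier →ₗ[k] N.carrier) (m : M.carrier) :
    evenPart h m = N.proj 0 (h (M.proj 0 m)) + N.proj 1 (h (M.proj 1 m)) := rfl

theorem evenPart_of_mem {M N : SuperModule k} (h : M.carrier →ₗ[k] N.carrier) {i : ZMod 2}
    {m : M.carrier} (hm : m ∈ M.gr i) : evenPart h m = N.proj i (h m) := by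
  rw [evenPart_apply, proj_of_mem M 0 hm, proj_of_mem M 1 hm]
  rcases parity_cases i with rfl | rfl <;> simp

theorem evenPart_mem {M N : SuperModule k} (h : M.carrier →ₗ[k] N.carrier) (i : ZMod 2)
    (m : M.carrier) (hm : m ∈ M.gr i) : evenPart h m ∈ N.gr i := by
  rw [evenPart_of_mem h hm]; exact N.proj_mem i _

/-- The even part of a linear map that commutes with the action is a homomorphism. -/
noncomputable def evenPartHom {M N : SuperModule k} (h : M.carrier →ₗ[k] N.carrier)
    (hMT : M.T = 0) (hNT : ∀ m, N.T (h m) = 0)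
    (hX : ∀ m, h (M.X m) = N.X (h m)) (hY : ∀ m, h (M.Y m) = N.Y (h m)) : Hom M N :=
  Hom.mk' (evenPart h) (evenPart_mem h)
    (fun m => by
      have hp : ∀ i m, N.T (N.proj i m) = N.proj i (N.T m) := fun i m =>
        map_proj (fun _ _ => N.T_mem) i m
      rw [hMT, LinearMap.zero_apply, map_zero]
      simp [evenPart_apply, hp, hNT])
    (fun m => by
      have e : (1 + 1 : ZMod 2) = 0 := rfl
      simp only [evenPart_apply, proj_X, hX, map_add, zero_add, e]
      abel)
    (fun m => by
      have e : (1 + 1 : ZMod 2) = 0 := rfl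
      simp only [evenPart_apply, proj_Y, hY, map_add, zero_add, e]
      abel)

/-- The map `(a, b, c, d) ↦ a + x b + y c + x y d` from four copies of a subspace. -/
def freeMap (P : SuperModule k) (U : Submodule k P.carrier) :
    (U × U × U × U) →ₗ[k] P.carrier :=
  U.subtype.coprod ((P.X ∘ₗ U.subtype).coprod ((P.Y ∘ₗ U.subtype).coprod
    (P.X ∘ₗ P.Y ∘ₗ U.subtype)))

theorem freeMap_apply (P : SuperModule k) (U : Submodule k P.carrier) (u : U × U × U × U) :
    P.freeMap U u = u.1 + (P.X u.2.1 + (P.Y u.2.2.1 + P.X (P.Y u.2.2.2))) := rfl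

/-- If `ker (x y)` is contained in the radical, then a complement of the radical generates the
supermodule freely over the exterior algebra on `x` and `y`. -/
theorem freeMap_bijective [CharZero k] (P : SuperModule k) (hT : P.T = 0)
    (hker : ∀ m, P.X (P.Y m) = 0 → m ∈ P.rad) {U : Submodule k P.carrier}
    (hU : IsCompl P.rad U) : Function.Bijective (P.freeMap U) := by
  have hYX := P.Y_X hT
  have key : ∀ u ∈ U, P.X (P.Y u) = 0 → u = 0 := fun u hu h =>
    Submodule.disjoint_def.1 hU.disjoint u (hker u h) hu
  constructor
  -- a relation `a + x b + y c + x y d = 0` is multiplied by `x y`, `y`, `x` and `1`, in turn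
  · rw [← LinearMap.ker_eq_bot, LinearMap.ker_eq_bot']
    rintro ⟨⟨a, ha⟩, ⟨b, hb⟩, ⟨c, hc⟩, ⟨d, hd⟩⟩ h
    rw [freeMap_apply] at h
    simp only at h
    have ha0 : a = 0 := key a ha (by
      have h1 := congrArg (fun m => P.X (P.Y m)) h
      simpa [X_X, Y_Y, hYX] using h1)
    subst ha0
    have hb0 : b = 0 := key b hb (by
      have h1 := congrArg (fun m => P.Y m) h
      simpa [X_X, Y_Y, hYX] using h1)
    subst hb0
    have hc0 : c = 0 := key c hc (by
      have h1 := congrArg (fun m => P.X m) h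
      simpa [X_X, Y_Y, hYX] using h1)
    subst hc0
    have hd0 : d = 0 := key d hd (by simpa using h)
    subst hd0
    rfl
  · have split : ∀ m, ∃ u ∈ U, ∃ a b, m = u + (P.X a + P.Y b) := by
      intro m
      have hm : m ∈ P.rad ⊔ U := by rw [hU.sup_eq_top]; trivial
      obtain ⟨r, hr, u, hu, rfl⟩ := Submodule.mem_sup.1 hm
      obtain ⟨a, b, rfl⟩ := mem_rad.1 hr
      exact ⟨u, hu, a, b, add_comm _ _⟩
    intro m
    obtain ⟨u, hu, a, b, rfl⟩ := split m
    obtain ⟨ua, hua, a1, a2, rfl⟩ := split a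
    obtain ⟨ub, hub, b1, b2, rfl⟩ := split b
    obtain ⟨u2, hu2, a3, a4, rfl⟩ := split a2
    obtain ⟨u1, hu1, b3, b4, rfl⟩ := split b1
    refine ⟨(⟨u, hu⟩, ⟨ua, hua⟩, ⟨ub, hub⟩, ⟨u2, hu2⟩ - ⟨u1, hu1⟩), ?_⟩
    rw [freeMap_apply]
    simp [X_X, Y_Y, hYX]
    abel

/-- A finite dimensional supermodule on which `t` acts by zero and which is free over the exterior
algebra on `x` and `y` is projective in `F`: the free generators are lifted to `t`-invariants. -/
theorem isProjective_of_ker_le_rad [CharZero k] (P : SuperModule k)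
    [FiniteDimensional k P.carrier] (hT : P.T = 0)
    (hker : ∀ m, P.X (P.Y m) = 0 → m ∈ P.rad) : P.IsProjective := by
  refine ⟨P.inF_of_T_eq_zero hT, fun M N hM hN g f hg => ?_⟩
  obtain ⟨U, hU⟩ := P.rad.exists_isCompl
  have hbij := P.freeMap_bijective hT hker hU
  let e := LinearEquiv.ofBijective (P.freeMap U) hbij
  -- a linear section of `g` on the `t`-invariants
  let gT : LinearMap.ker M.T →ₗ[k] LinearMap.ker N.T :=
    (g.toLin ∘ₗ (LinearMap.ker M.T).subtype).codRestrict _ (fun m => by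
      rw [LinearMap.mem_ker, LinearMap.comp_apply, ← g.map_T]
      simp)
  have hgT : Function.Surjective gT := by
    rintro ⟨n, hn⟩
    obtain ⟨c, hc, rfl⟩ := hM.exists_lift_ker hN g hg (LinearMap.mem_ker.1 hn)
    exact ⟨⟨c, hc⟩, rfl⟩
  obtain ⟨s, hs⟩ := gT.exists_rightInverse_of_surjective (LinearMap.range_eq_top.2 hgT)
  let fT : U →ₗ[k] LinearMap.ker N.T :=
    (f.toLin ∘ₗ U.subtype).codRestrict _ (fun m => by
      rw [LinearMap.mem_ker, LinearMap.comp_apply, ← f.map_T, hT]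
      simp)
  let σ : U →ₗ[k] M.carrier := (LinearMap.ker M.T).subtype ∘ₗ s ∘ₗ fT
  have hσT : ∀ u, M.T (σ u) = 0 := fun u => (s (fT u)).2
  have hgσ : ∀ u, g.toLin (σ u) = f.toLin u := fun u =>
    congrArg Subtype.val (LinearMap.congr_fun hs (fT u))
  let h' : (U × U × U × U) →ₗ[k] M.carrier :=
    σ.coprod ((M.X ∘ₗ σ).coprod ((M.Y ∘ₗ σ).coprod (M.X ∘ₗ M.Y ∘ₗ σ)))
  have h'_apply : ∀ u, h' u = σ u.1 + (M.X (σ u.2.1) + (M.Y (σ u.2.2.1) +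
    M.X (M.Y (σ u.2.2.2)))) := fun u => rfl
  let h := h' ∘ₗ e.symm.toLinearMap
  have h_e : ∀ u, h (P.freeMap U u) = h' u := fun u => congrArg h' (e.symm_apply_apply u)
  have hYX := P.Y_X hT
  have hTm : ∀ m, M.T (h m) = 0 := by
    intro m
    obtain ⟨u, rfl⟩ := hbij.2 m
    rw [h_e, h'_apply]
    simp [T_X, T_Y, hσT]
  have hX : ∀ m, h (P.X m) = M.X (h m) := by
    intro m
    obtain ⟨u, rfl⟩ := hbij.2 m
    have e1 : P.X (P.freeMap U u) = P.freeMap U (0, u.1, 0, u.2.2.1) := by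
      simp [freeMap_apply, X_X]
    rw [e1, h_e, h_e, h'_apply, h'_apply]
    simp [X_X]
  have hY : ∀ m, h (P.Y m) = M.Y (h m) := by
    intro m
    obtain ⟨u, rfl⟩ := hbij.2 m
    have e1 : P.Y (P.freeMap U u) = P.freeMap U (0, 0, u.1, - u.2.1) := by
      simp [freeMap_apply, Y_Y, hYX]
    rw [e1, h_e, h_e, h'_apply, h'_apply]
    simp [Y_Y, Y_X_eq, hσT, T_Y]
  have hgh : ∀ m, g.toLin (h m) = f.toLin m := by
    intro m
    obtain ⟨u, rfl⟩ := hbij.2 m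
    rw [h_e, h'_apply, freeMap_apply]
    simp [g.map_X, g.map_Y, f.map_X, f.map_Y, hgσ]
  -- `h` need not be even, but its even part is still a lift
  refine ⟨evenPartHom h hT hTm hX hY, fun m => ?_⟩
  change g.toLin (evenPart h m) = _
  rw [evenPart_apply, map_add, map_proj g.map_gr, map_proj g.map_gr, hgh, hgh,
    map_proj f.map_gr, map_proj f.map_gr, proj_of_mem N 0 (N.proj_mem 0 _),
    proj_of_mem N 1 (N.proj_mem 1 _)]
  simp [proj_add_proj]

/-! ### Exactness at every odd element implies projectivity -/

/-- An analogue of Dade's lemma: a finite dimensional supermodule on which `t` acts by zero is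
projective if the complex given by every nonzero odd element is exact. If `ker (x y)` were larger
than the radical, then `y = x φ` would define an endomorphism `φ` of `ker (x y) / rad`, and an
eigenvector of `φ` for `c` would give an element of `ker (y - c x)` outside of the radical. -/
theorem isProjective_of_exact [IsAlgClosed k] [CharZero k] (Q : SuperModule k)
    [FiniteDimensional k Q.carrier] (hT : Q.T = 0)
    (hex : ∀ z ∈ part k 1, z ≠ 0 → ∀ q, Q.act z q = 0 → ∃ p, Q.act z p = q) :
    Q.IsProjective := by
  refine Q.isProjective_of_ker_le_rad hT ?_
  by_contra! hcon
  obtain ⟨q₀, hq₀, hq₀'⟩ := hcon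
  have hYX := Q.Y_X hT
  have hexX : ∀ q, Q.X q = 0 → ∃ p, Q.X p = q := by
    have h := hex ((1 : k) • x k + (0 : k) • y k) (smul_x_add_smul_y_mem_part _ _)
      (smul_x_add_smul_y_ne_zero (Or.inl one_ne_zero))
    simpa [act_odd, X, Y] using h
  obtain ⟨θ, hθ⟩ := (Q.X.rangeRestrict).exists_rightInverse_of_surjective
    (LinearMap.range_rangeRestrict _)
  let K := LinearMap.ker (Q.X ∘ₗ Q.Y)
  have hK : ∀ q : K, Q.Y q ∈ LinearMap.range Q.X := fun q => by
    obtain ⟨p, hp⟩ := hexX _ (LinearMap.mem_ker.1 q.2)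
    exact ⟨p, hp⟩
  -- exactness at `x` gives `φ₀` with `x φ₀ = y` on the kernel `K` of `x y`
  let φ₀ : K →ₗ[k] Q.carrier := θ ∘ₗ (Q.Y ∘ₗ K.subtype).codRestrict _ hK
  have hφ₀ : ∀ q : K, Q.X (φ₀ q) = Q.Y q := fun q =>
    congrArg Subtype.val (LinearMap.congr_fun hθ ⟨Q.Y q, hK q⟩)
  let φ : K →ₗ[k] K := φ₀.codRestrict K (fun q => by
    rw [LinearMap.mem_ker, LinearMap.comp_apply, ← neg_eq_zero, ← hYX, hφ₀, Y_Y])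
  have hφ : ∀ q : K, Q.X (φ q) = Q.Y q := hφ₀
  let R : Submodule k K := Q.rad.comap K.subtype
  have hR : R ≤ R.comap φ := by
    rintro ⟨q, hqK⟩ hq
    obtain ⟨a, b, rfl⟩ := mem_rad.1 (show q ∈ Q.rad from hq)
    have h1 : Q.X ((φ ⟨_, hqK⟩ : K) + Q.Y a) = 0 := by
      rw [map_add, hφ, map_add, Y_Y, hYX]; simp
    obtain ⟨p, hp⟩ := hexX _ h1
    change ((φ ⟨_, hqK⟩ : K) : Q.carrier) ∈ Q.rad
    rw [← add_sub_cancel_right ((φ ⟨_, hqK⟩ : K) : Q.carrier) (Q.Y a), ← hp]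
    exact sub_mem (Q.X_mem_rad _) (Q.Y_mem_rad _)
  have hnt : Nontrivial (K ⧸ R) := by
    refine Submodule.Quotient.nontrivial_iff.2 fun h => hq₀' ?_
    have : (⟨q₀, hq₀⟩ : K) ∈ R := by rw [h]; trivial
    exact this
  obtain ⟨c, hc⟩ := Module.End.exists_eigenvalue (R.mapQ R φ hR)
  obtain ⟨v, hv⟩ := hc.exists_hasEigenvector
  obtain ⟨q, rfl⟩ := R.mkQ_surjective v
  have h1 : φ q - c • q ∈ R := by
    rw [← R.ker_mkQ, LinearMap.mem_ker, map_sub, map_smul]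
    exact sub_eq_zero.2 hv.apply_eq_smul
  have h2 : q ∉ R := fun h => hv.2 (by rwa [← LinearMap.mem_ker, R.ker_mkQ])
  obtain ⟨a, b, hab⟩ := mem_rad.1 (show ((φ q - c • q : K) : Q.carrier) ∈ Q.rad from h1)
  have h3 : Q.Y q = c • Q.X q + Q.X (Q.Y b) := by
    have h := congrArg Q.X hab
    rw [Submodule.coe_sub, Submodule.coe_smul, map_sub, hφ, map_add, X_X, zero_add, map_smul] at h
    rw [h]; abel
  -- the eigenvector, corrected by an element of the radical, is killed by `y - c x`
  have h4 := hex ((-c) • x k + (1 : k) • y k) (smul_x_add_smul_y_mem_part _ _)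
      (smul_x_add_smul_y_ne_zero (Or.inr one_ne_zero)) (q + Q.X b) (by
    rw [act_odd, map_add, map_add, X_X, hYX, h3]
    simp)
  obtain ⟨p, hp⟩ := h4
  rw [act_odd] at hp
  refine h2 (show (q : Q.carrier) ∈ Q.rad from ?_)
  rw [← add_sub_cancel_right (q : Q.carrier) (Q.X b), ← hp]
  exact sub_mem (add_mem (Submodule.smul_mem _ _ (Q.X_mem_rad _))
    (Submodule.smul_mem _ _ (Q.Y_mem_rad _))) (Q.X_mem_rad _)

/-! ### Indecomposable supermodules -/

/-- The kernel of a homomorphism is a subsupermodule. -/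
theorem isSub_ker {M N : SuperModule k} (f : Hom M N) : M.IsSub (LinearMap.ker f.toLin) := by
  refine ⟨le_antisymm (fun m hm => ?_) (sup_le inf_le_left inf_le_left), fun A m hm => ?_⟩
  · rw [← M.proj_add_proj m]
    have h : ∀ i, M.proj i m ∈ LinearMap.ker f.toLin := fun i => by
      rw [LinearMap.mem_ker] at hm ⊢
      rw [map_proj f.map_gr, hm, map_zero]
    exact Submodule.add_mem_sup ⟨h 0, M.proj_mem 0 m⟩ ⟨h 1, M.proj_mem 1 m⟩
  · rw [LinearMap.mem_ker] at hm ⊢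
    rw [f.map_act, hm, map_zero]

/-- The range of a homomorphism is a subsupermodule. -/
theorem isSub_range {M N : SuperModule k} (f : Hom M N) : N.IsSub (LinearMap.range f.toLin) := by
  refine ⟨le_antisymm ?_ (sup_le inf_le_left inf_le_left), ?_⟩
  · rintro _ ⟨m, rfl⟩
    rw [← N.proj_add_proj (f.toLin m)]
    have h : ∀ i, N.proj i (f.toLin m) ∈ LinearMap.range f.toLin := fun i =>
      ⟨M.proj i m, map_proj f.map_gr i m⟩
    exact Submodule.add_mem_sup ⟨h 0, N.proj_mem 0 _⟩ ⟨h 1, N.proj_mem 1 _⟩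
  · rintro A _ ⟨m, rfl⟩
    exact ⟨M.act A m, f.map_act A m⟩

theorem Indecomposable.eq_zero_or_eq_id {M : SuperModule k} (hM : M.Indecomposable) (e : Hom M M)
    (he : ∀ m, e.toLin (e.toLin m) = e.toLin m) :
    (∀ m, e.toLin m = 0) ∨ ∀ m, e.toLin m = m := by
  have hid : IsIdempotentElem e.toLin := LinearMap.ext he
  rcases hM.2 _ _ (isSub_range e) (isSub_ker e) (LinearMap.IsIdempotentElem.isCompl hid) with h | h
  · left
    rw [LinearMap.range_eq_bot] at h
    intro m; rw [h]; rfl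
  · right
    intro m
    have h1 : m - e.toLin m ∈ LinearMap.ker e.toLin := by
      rw [LinearMap.mem_ker, map_sub, he, sub_self]
    rw [h, Submodule.mem_bot] at h1
    exact (sub_eq_zero.1 h1).symm

/-- If `x y` does not vanish on an indecomposable supermodule killed by `t`, then a homogeneous
vector `m` with `x y m ≠ 0` spans a free supermodule of rank one, which is a direct summand because
the exterior algebra on `x` and `y` is self-injective: the projection is written down in terms of a
homogeneous linear form that does not vanish at `x y m`. -/
theorem Indecomposable.X_Y_eq_zero [CharZero k] {M : SuperModule k} (hM : M.Indecomposable)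
    [FiniteDimensional k M.carrier] (hT : M.T = 0) (hproj : ¬ M.IsProjective) (v : M.carrier) :
    M.X (M.Y v) = 0 := by
  have hYX := M.Y_X hT
  suffices h : M.X ∘ₗ M.Y = 0 from LinearMap.congr_fun h v
  refine M.end_ext fun j m hm => ?_
  by_contra hne
  rw [LinearMap.comp_apply, LinearMap.zero_apply] at hne
  obtain ⟨φ₀, hφ₀⟩ := Module.Projective.exists_dual_eq_one k hne
  -- `φ` vanishes on the part of parity `j + 1`
  let φ : M.carrier →ₗ[k] k := φ₀ ∘ₗ M.proj j
  have hφ : ∀ m ∈ M.gr (j + 1), φ m = 0 := fun m hm => by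
    change φ₀ (M.proj j m) = 0
    rw [proj_of_mem M j hm, if_neg (by clear * -; revert j; decide), map_zero]
  have hXYm : M.X (M.Y m) ∈ M.gr j := by
    have h := M.X_mem (M.Y_mem hm)
    rwa [add_one_add_one] at h
  have hφ1 : φ (M.X (M.Y m)) = 1 := by
    change φ₀ (M.proj j (M.X (M.Y m))) = 1
    rw [proj_of_mem M j hXYm, if_pos rfl, hφ₀]
  let π₀ : Module.End k M.carrier :=
    (φ ∘ₗ M.X ∘ₗ M.Y).smulRight m + (φ ∘ₗ M.X).smulRight (M.Y m)
      - (φ ∘ₗ M.Y).smulRight (M.X m) + (φ - φ m • (φ ∘ₗ M.X ∘ₗ M.Y)).smulRight (M.X (M.Y m))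
  have hπ₀ : ∀ v, π₀ v = φ (M.X (M.Y v)) • m + φ (M.X v) • M.Y m - φ (M.Y v) • M.X m
      + (φ v - φ m * φ (M.X (M.Y v))) • M.X (M.Y m) := fun v => rfl
  have hπX : ∀ v, π₀ (M.X v) = M.X (π₀ v) := fun v => by
    simp only [hπ₀, map_add, map_sub, map_smul, hYX, X_X, map_neg, map_zero, neg_zero, mul_zero,
      sub_zero, zero_smul, smul_zero, neg_smul, sub_neg_eq_add, zero_add, add_zero]
  have hπY : ∀ v, π₀ (M.Y v) = M.Y (π₀ v) := fun v => by
    simp only [hπ₀, map_add, map_sub, map_smul, hYX, Y_Y, map_zero, neg_zero, mul_zero,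
      sub_zero, zero_smul, smul_zero, smul_neg, sub_neg_eq_add, zero_add, add_zero]
  have hπm : π₀ m = m := by
    rw [hπ₀, hφ1, hφ _ (M.X_mem hm), hφ _ (M.Y_mem hm)]
    simp
  have hgr : ∀ i, ∀ v ∈ M.gr i, π₀ v ∈ M.gr i := by
    intro i v hv
    rw [hπ₀]
    by_cases hij : i = j
    · subst hij
      rw [hφ _ (M.X_mem hv), hφ _ (M.Y_mem hv), zero_smul, zero_smul, add_zero, sub_zero]
      exact add_mem (Submodule.smul_mem _ _ hm) (Submodule.smul_mem _ _ hXYm)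
    · obtain rfl : i = j + 1 := by clear * - hij; revert i j; decide
      have hXYv := M.X_mem (M.Y_mem hv)
      rw [add_one_add_one] at hXYv
      rw [hφ _ hv, hφ _ hXYv, mul_zero, sub_zero, zero_smul, zero_smul,
        zero_add, add_zero]
      exact sub_mem (Submodule.smul_mem _ _ (M.Y_mem hm)) (Submodule.smul_mem _ _ (M.X_mem hm))
  let π : Hom M M := Hom.mk' π₀ hgr (fun m => by rw [hT]; simp) hπX hπY
  have hidem : ∀ v, π₀ (π₀ v) = π₀ v := by
    intro v
    conv_lhs => rw [hπ₀ v]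
    simp only [map_add, map_sub, map_smul, hπX, hπY, hπm]
    rw [← hπ₀]
  rcases hM.eq_zero_or_eq_id π hidem with h | h
  · have h1 : π₀ m = 0 := h m
    rw [hπm] at h1
    rw [h1, map_zero, map_zero] at hne
    exact hne rfl
  · refine hproj (M.isProjective_of_ker_le_rad hT fun v hv => ?_)
    have h1 : π₀ v = v := h v
    rw [← h1, hπ₀, hv, map_zero, zero_smul, zero_add]
    exact add_mem (sub_mem (Submodule.smul_mem _ _ (M.Y_mem_rad _))
      (Submodule.smul_mem _ _ (M.X_mem_rad _))) (Submodule.smul_mem _ _ (M.X_mem_rad _))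

/-- On an indecomposable supermodule killed by `t` and `x y`, all of `x`, `y` and `t` annihilate
one of the two homogeneous parts. -/
theorem Indecomposable.exists_parity [CharZero k] {M : SuperModule k} (hM : M.Indecomposable)
    (hT : M.T = 0) (hXY : ∀ v, M.X (M.Y v) = 0) :
    ∃ i, ∀ m ∈ M.gr i, M.X m = 0 ∧ M.Y m = 0 := by
  have hYX := M.Y_X hT
  have hXr : ∀ m ∈ M.rad, M.X m = 0 := by
    intro m hm
    obtain ⟨a, b, rfl⟩ := mem_rad.1 hm
    rw [map_add, X_X, hXY, add_zero]
  have hYr : ∀ m ∈ M.rad, M.Y m = 0 := by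
    intro m hm
    obtain ⟨a, b, rfl⟩ := mem_rad.1 hm
    rw [map_add, Y_Y, hYX, hXY, neg_zero, add_zero]
  have hpr : ∀ i, ∀ m ∈ M.rad, M.proj i m ∈ M.rad := by
    intro i m hm
    obtain ⟨a, b, rfl⟩ := mem_rad.1 hm
    rw [map_add, proj_X, proj_Y]
    exact mem_rad.2 ⟨_, _, rfl⟩
  obtain ⟨U, hU⟩ := M.rad.exists_isCompl
  -- an even projection onto the radical
  let ρ := evenPart (M := M) (N := M) (M.rad.projection U hU)
  have hρ_mem : ∀ m, ρ m ∈ M.rad := fun m => by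
    rw [evenPart_apply]
    exact add_mem (hpr _ _ (Submodule.projection_apply_mem _ _))
      (hpr _ _ (Submodule.projection_apply_mem _ _))
  have hρ : ∀ m ∈ M.rad, ρ m = m := fun m hm => by
    rw [evenPart_apply, Submodule.projection_apply_of_mem_left _ (hpr 0 m hm),
      Submodule.projection_apply_of_mem_left _ (hpr 1 m hm),
      proj_of_mem M 0 (M.proj_mem 0 _), proj_of_mem M 1 (M.proj_mem 1 _)]
    simp [proj_add_proj]
  have hρp : ∀ i m, ρ (M.proj i m) = M.proj i (ρ m) := fun i m =>
    map_proj (evenPart_mem _) i m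
  have hpp : ∀ i m, M.proj i (M.proj i m) = M.proj i m := fun i m => by
    rw [proj_of_mem M i (M.proj_mem i m), if_pos rfl]
  have hp01 : ∀ m, M.proj 0 (M.proj 1 m) = 0 := fun m => by
    rw [proj_of_mem M 0 (M.proj_mem 1 m), if_neg (by decide)]
  have hp10 : ∀ m, M.proj 1 (M.proj 0 m) = 0 := fun m => by
    rw [proj_of_mem M 1 (M.proj_mem 0 m), if_neg (by decide)]
  -- the projection onto a complement of the radical in degree `0` plus the radical in degree `1`
  let e₀ : Module.End k M.carrier := M.proj 0 - ρ ∘ₗ M.proj 0 + ρ ∘ₗ M.proj 1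
  have he₀ : ∀ m, e₀ m = M.proj 0 m - ρ (M.proj 0 m) + ρ (M.proj 1 m) := fun m => rfl
  have e2 : (1 + 1 : ZMod 2) = 0 := rfl
  have hcomm : ∀ (Z : Module.End k M.carrier), (∀ m, Z m ∈ M.rad) → (∀ m ∈ M.rad, Z m = 0) →
      (∀ i m, M.proj i (Z m) = Z (M.proj (i + 1) m)) → ∀ m, e₀ (Z m) = Z (e₀ m) := by
    intro Z h1 h2 h3 m
    rw [he₀, he₀, map_add, map_sub, h2 _ (hρ_mem _), h2 _ (hρ_mem _), hρ _ (hpr _ _ (h1 m)),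
      hρ _ (hpr _ _ (h1 m)), h3 1, e2, sub_self, sub_zero, zero_add, add_zero]
  let e : Hom M M := Hom.mk' e₀
    (fun i m hm => by
      rw [he₀]
      rcases parity_cases i with rfl | rfl
      · rw [proj_of_mem M 0 hm, proj_of_mem M 1 hm, if_pos rfl, if_neg (by decide), map_zero,
          add_zero]
        exact sub_mem hm (evenPart_mem _ _ _ hm)
      · rw [proj_of_mem M 0 hm, proj_of_mem M 1 hm, if_pos rfl, if_neg (by decide), map_zero,
          sub_zero, zero_add]
        exact evenPart_mem _ _ _ hm)
    (fun m => by rw [hT]; simp)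
    (hcomm M.X M.X_mem_rad hXr M.proj_X) (hcomm M.Y M.Y_mem_rad hYr M.proj_Y)
  have hidem : ∀ m, e₀ (e₀ m) = e₀ m := by
    intro m
    simp only [he₀, map_add, map_sub, hρp, hpp, hp01, hp10, hρ _ (hρ_mem _)]
    simp
  rcases hM.eq_zero_or_eq_id e hidem with h | h
  · refine ⟨0, fun m hm => ?_⟩
    have h1 : e₀ m = 0 := h m
    rw [he₀, proj_of_mem M 0 hm, proj_of_mem M 1 hm, if_pos rfl, if_neg (by decide), map_zero,
      add_zero, sub_eq_zero] at h1
    rw [h1]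
    exact ⟨hXr _ (hρ_mem _), hYr _ (hρ_mem _)⟩
  · refine ⟨1, fun m hm => ?_⟩
    have h1 : e₀ m = m := h m
    rw [he₀, proj_of_mem M 0 hm, proj_of_mem M 1 hm, if_pos rfl, if_neg (by decide), map_zero,
      sub_zero, zero_add] at h1
    rw [← h1]
    exact ⟨hXr _ (hρ_mem _), hYr _ (hρ_mem _)⟩

end SuperModule

/-! ### Pencils of linear maps -/

section Pencil
variable {k V W : Type*} [Field k] [AddCommGroup V] [Module k V] [AddCommGroup W] [Module k W]

/-- A sequence `v` with `A (v 0) = 0`, `A (v (s + 1)) = B (v s)` and `v s = 0` for `s > d`. It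
encodes the polynomial `∑ v s X ^ s` of degree at most `d` in the kernel of `A - X B`. -/
structure IsKernelChain (A B : V →ₗ[k] W) (d : ℕ) (v : ℕ → V) : Prop where
  zero : A (v 0) = 0
  succ : ∀ s, A (v (s + 1)) = B (v s)
  eq_zero : ∀ s, d < s → v s = 0

/-- If no member of a pencil is injective, then the determinant of the generic member vanishes, so
that there is a polynomial vector in its kernel. -/
theorem exists_isKernelChain [Infinite k] [FiniteDimensional k V] [FiniteDimensional k W]
    (A B : V →ₗ[k] W) (hdim : Module.finrank k W ≤ Module.finrank k V)
    (h : ∀ c : k, ∃ v, v ≠ 0 ∧ A v = c • B v) :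
    ∃ d v, IsKernelChain A B d v ∧ v ≠ 0 := by
  -- an embedding of `W` into `V` makes the matrices square
  obtain ⟨j, hj⟩ := finrank_le_iff_exists_linearMap.1 hdim
  let b := Module.finBasis k V
  let A' := LinearMap.toMatrix b b (j ∘ₗ A)
  let B' := LinearMap.toMatrix b b (j ∘ₗ B)
  let P : Matrix (Fin (Module.finrank k V)) (Fin (Module.finrank k V)) (Polynomial k) :=
    A'.map Polynomial.C - (Polynomial.X : Polynomial k) • B'.map Polynomial.C
  have hdet : P.det = 0 := by
    refine Polynomial.funext fun c => ?_
    rw [Polynomial.eval_zero, ← Polynomial.coe_evalRingHom, RingHom.map_det]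
    obtain ⟨v, hv, hAv⟩ := h c
    refine Matrix.exists_mulVec_eq_zero_iff.1 ⟨b.repr v, ?_, ?_⟩
    · intro h0
      refine hv (b.repr.map_eq_zero_iff.1 (DFunLike.coe_injective h0))
    · have hP : (Polynomial.evalRingHom c).mapMatrix P = A' - c • B' := by
        ext i l
        simp [P, -mul_eq_mul_left_iff, -mul_eq_mul_right_iff]
        exact mul_comm _ _
      rw [hP, Matrix.sub_mulVec, Matrix.smul_mulVec, LinearMap.toMatrix_mulVec_repr,
        LinearMap.toMatrix_mulVec_repr]
      simp [hAv]
  obtain ⟨p, hp, hPp⟩ := Matrix.exists_mulVec_eq_zero_iff.2 hdet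
  let v : ℕ → V := fun s => ∑ i, (p i).coeff s • b i
  have hrepr : ∀ s, (b.repr (v s) : _ → k) = fun i => (p i).coeff s := fun s => by
    ext i
    simp only [v, map_sum, map_smul, Module.Basis.repr_self, Finsupp.coe_finsetSum,
      Finset.sum_apply, Finsupp.smul_apply, Finsupp.single_apply]
    simp
  have hA : ∀ (C : V →ₗ[k] W) s i, b.repr (j (C (v s))) i =
      ∑ l, LinearMap.toMatrix b b (j ∘ₗ C) i l * (p l).coeff s := fun C s i => by
    have := congrFun (LinearMap.toMatrix_mulVec_repr b b (j ∘ₗ C) (v s)) i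
    rw [LinearMap.comp_apply] at this
    rw [← this, hrepr]
    rfl
  have hrow : ∀ i, ∑ l, (Polynomial.C (A' i l) * p l - Polynomial.X * (Polynomial.C (B' i l) * p l))
      = 0 := fun i => by
    have := congrFun hPp i
    simp only [P, Matrix.mulVec, dotProduct, Matrix.sub_apply, Matrix.map_apply, Matrix.smul_apply,
      smul_eq_mul, sub_mul, mul_assoc, Pi.zero_apply] at this
    exact this
  have hinj : ∀ a b' : W, (∀ i, b.repr (j a) i = b.repr (j b') i) → a = b' := fun a b' hab =>
    hj (b.repr.injective (Finsupp.ext hab))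
  refine ⟨Finset.univ.sup fun i => (p i).natDegree, v, ⟨?_, fun s => ?_, fun s hs => ?_⟩, ?_⟩
  · refine hinj _ _ fun i => ?_
    have := congrArg (fun q => q.coeff 0) (hrow i)
    simp only [Polynomial.finsetSum_coeff, Polynomial.coeff_sub, Polynomial.coeff_C_mul,
      Polynomial.coeff_X_mul_zero, sub_zero, Polynomial.coeff_zero] at this
    rw [hA, map_zero, map_zero]
    exact this
  · refine hinj _ _ fun i => ?_
    have := congrArg (fun q => q.coeff (s + 1)) (hrow i)
    simp only [Polynomial.finsetSum_coeff, Polynomial.coeff_sub, Polynomial.coeff_C_mul,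
      Polynomial.coeff_X_mul, Polynomial.coeff_zero, Finset.sum_sub_distrib] at this
    rw [hA, hA]
    exact sub_eq_zero.1 this
  · refine Finset.sum_eq_zero fun i _ => ?_
    rw [Polynomial.coeff_eq_zero_of_natDegree_lt, zero_smul]
    exact (Finset.le_sup (f := fun i => (p i).natDegree) (Finset.mem_univ i)).trans_lt hs
  · intro h0
    refine hp (funext fun i => Polynomial.ext fun s => ?_)
    have := congrFun (hrepr s) i
    rw [h0] at this
    simpa using this.symm

/-- Kronecker's reduction: a pencil without injective members splits off a minimal pencil `L_ε`.
The vectors `v i` and `B (v i)` span a copy of `L_ε`, and the linear forms `f i` and `g i` are the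
coordinates of a retraction onto it.

Take for `v` a kernel chain of minimal degree `ε`. A family of linear forms with
`g i ∘ A = g (i + 1) ∘ B` is a linear form on the sequences in `W` that vanishes on the sequences
`(A (u i) - B (u (i - 1)))`. By minimality, `(B (v 0), 0, 0, …)` is not such a sequence, so `g` can
be chosen with `g 0 (B (v 0)) = 1`, and the other values `g i (B (v j))` follow from this. -/
theorem exists_retraction_of_forall_not_injective [Infinite k] [FiniteDimensional k V]
    [FiniteDimensional k W]
    (A B : V →ₗ[k] W) (hdim : Module.finrank k W ≤ Module.finrank k V)
    (h : ∀ c : k, ∃ v, v ≠ 0 ∧ A v = c • B v) :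
    ∃ (ε : ℕ) (v : ℕ → V) (f : ℕ → V →ₗ[k] k) (g : ℕ → W →ₗ[k] k),
      IsKernelChain A B ε v ∧
      (∀ i < ε, g i ∘ₗ A = f (i + 1)) ∧ (∀ i < ε, g i ∘ₗ B = f i) ∧
      (∀ i ≤ ε, ∀ j ≤ ε, f i (v j) = if i = j then 1 else 0) ∧
      (∀ i < ε, ∀ j < ε, g i (B (v j)) = if i = j then 1 else 0) := by
  classical
  have hex := exists_isKernelChain A B hdim h
  obtain ⟨v, hv, hv0⟩ := Nat.find_spec hex
  have hmin : ∀ d < Nat.find hex, ∀ v', IsKernelChain A B d v' → v' = 0 := fun d hd v' hv' => by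
    by_contra hne
    exact Nat.find_min hex hd ⟨v', hv', hne⟩
  generalize Nat.find hex = ε at *
  -- if `v 0 = 0`, then shifting the chain lowers its degree
  have hv0' : v 0 ≠ 0 := by
    intro h0
    rcases Nat.eq_zero_or_pos ε with rfl | hε
    · refine hv0 (funext fun s => ?_)
      rcases s with _ | s
      · exact h0
      · exact hv.eq_zero _ (Nat.succ_pos s)
    · have h1 := hmin (ε - 1) (by omega) (fun s => v (s + 1))
        ⟨by rw [hv.succ, h0, map_zero], fun s => hv.succ (s + 1),
          fun s hs => hv.eq_zero _ (by omega)⟩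
      refine hv0 (funext fun s => ?_)
      rcases s with _ | s
      · exact h0
      · exact congrFun h1 s
  have hBε : ∀ s, ε ≤ s → B (v s) = 0 := fun s hs => by
    rw [← hv.succ, hv.eq_zero _ (by omega), map_zero]
  rcases ε with _ | e
  · obtain ⟨φ, hφ⟩ := Module.Projective.exists_dual_eq_one k hv0'
    refine ⟨0, v, fun _ => φ, fun _ => 0, hv, by simp, by simp, ?_, by simp⟩
    intro i hi j hj
    obtain rfl : i = 0 := by omega
    obtain rfl : j = 0 := by omega
    simpa using hφ
  let Ψ : (ℕ → V) →ₗ[k] (ℕ → W) := LinearMap.pi fun i =>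
    A ∘ₗ LinearMap.proj i - Nat.casesOn i 0 (fun i' => B ∘ₗ LinearMap.proj i')
  have hΨ0 : ∀ u, Ψ u 0 = A (u 0) := fun u => by simp [Ψ]
  have hΨs : ∀ u i, Ψ u (i + 1) = A (u (i + 1)) - B (u i) := fun u i => by simp [Ψ]
  let S : Submodule k (ℕ → V) := ⨅ s ∈ Set.Ici e, LinearMap.ker (LinearMap.proj s)
  have hS : ∀ u, u ∈ S ↔ ∀ s, e ≤ s → u s = 0 := fun u => by simp [S]
  -- a preimage `u` would give the kernel chain `v 0, u 0, u 1, …` of degree `e`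
  have hnot : Pi.single 0 (B (v 0)) ∉ S.map Ψ := by
    rintro ⟨u, hu, hΨu⟩
    have hu' := (hS u).1 hu
    have h1 := hmin e (Nat.lt_succ_self e) (fun s => Nat.casesOn s (v 0) u) ⟨hv.zero, fun s => by
      rcases s with _ | s
      · have := congrFun hΨu 0
        rw [hΨ0, Pi.single_eq_same] at this
        exact this
      · have := congrFun hΨu (s + 1)
        rw [hΨs, Pi.single_eq_of_ne (Nat.succ_ne_zero s)] at this
        exact sub_eq_zero.1 this, fun s hs => by
      rcases s with _ | s
      · omega
      · exact hu' s (by omega)⟩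
    exact hv0' (congrFun h1 0)
  obtain ⟨G₀, hG₀, hG₀S⟩ := Submodule.exists_le_ker_of_notMem hnot
  let G := (G₀ (Pi.single 0 (B (v 0))))⁻¹ • G₀
  have hG1 : G (Pi.single 0 (B (v 0))) = 1 := by simp [G, hG₀]
  have hGS : ∀ u ∈ S, G (Ψ u) = 0 := fun u hu => by
    have : G₀ (Ψ u) = 0 := hG₀S ⟨u, hu, rfl⟩
    simp [G, this]
  let g : ℕ → W →ₗ[k] k := fun i => G ∘ₗ LinearMap.single k (fun _ => W) i
  have hgAB : ∀ i < e, ∀ v', g i (A v') = g (i + 1) (B v') := fun i hi v' => by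
    have h1 := hGS (Pi.single i v') ((hS _).2 fun s hs => Pi.single_eq_of_ne (by omega) _)
    have h2 : Ψ (Pi.single i v') = Pi.single i (A v') - Pi.single (i + 1) (B v') := by
      ext s
      rcases s with _ | s
      · rw [hΨ0]
        by_cases h0 : i = 0
        · subst h0; simp
        · simp [Ne.symm h0]
      · rw [hΨs]
        simp only [Pi.single_apply, Pi.sub_apply]
        by_cases h1 : s + 1 = i
        · have : s ≠ i := by omega
          simp [h1, this]
        · by_cases h2 : s = i <;> simp [h1, h2]
    rw [h2, map_sub, sub_eq_zero] at h1
    exact h1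
  -- the value `g i (B (v j))` depends only on `j - i`, and vanishes at both ends
  have hshift : ∀ i ≤ e, ∀ j, g 0 (B (v j)) = g i (B (v (j + i))) := by
    intro i
    induction i with
    | zero => intro _ j; rfl
    | succ i ih =>
      intro hi j
      rw [ih (by omega), ← hv.succ, hgAB i (by omega)]
      rfl
  have hgB : ∀ i < e + 1, ∀ j, g i (B (v j)) = if i = j then 1 else 0 := by
    intro i
    induction i with
    | zero =>
      intro _ j
      rcases j with _ | j
      · rw [if_pos rfl]; exact hG1
      · rw [hshift e le_rfl, hBε _ (by omega), map_zero, if_neg (by omega)]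
    | succ i ih =>
      intro hi j
      rw [← hgAB i (by omega)]
      rcases j with _ | j
      · rw [hv.zero, map_zero, if_neg (by omega)]
      · rw [hv.succ, ih (by omega)]; simp
  refine ⟨e + 1, v, fun i => if i < e + 1 then g i ∘ₗ B else g e ∘ₗ A, g, hv, ?_, ?_, ?_,
    fun i hi j _ => hgB i hi j⟩
  · intro i hi
    beta_reduce
    by_cases hie : i = e
    · subst hie; simp
    · have : i < e := by omega
      rw [if_pos (by omega)]
      exact LinearMap.ext (hgAB i this)
  · intro i hi
    beta_reduce
    rw [if_pos hi]
  · intro i hi j hj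
    beta_reduce
    by_cases hie : i < e + 1
    · rw [if_pos hie]
      exact hgB i hie j
    · obtain rfl : i = e + 1 := by omega
      rw [if_neg hie]
      rcases j with _ | j
      · rw [LinearMap.comp_apply, hv.zero, map_zero, if_neg (by omega)]
      · rw [LinearMap.comp_apply, hv.succ, hgB e (by omega)]
        simp

end Pencil

namespace SuperModule

variable {k : Type u} [Field k]

/-! ### Retracts -/

/-- `N` is a retract of `M`: there are homomorphisms `s : N → M` and `r : M → N` with
`r ∘ s = id`. -/
def IsRetract (M N : SuperModule k) : Prop :=
  ∃ (r : Hom M N) (s : Hom N M), ∀ n, r.toLin (s.toLin n) = n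

theorem IsRetract.isIso {M N : SuperModule k} (h : M.IsRetract N) (hM : M.Indecomposable)
    (hN : Nontrivial N.carrier) : M.IsIso N := by
  obtain ⟨r, s, hrs⟩ := h
  let e : Hom M M := ⟨s.toLin ∘ₗ r.toLin, fun i m hm => s.map_gr i _ (r.map_gr i m hm),
    fun A m => by simp only [LinearMap.comp_apply, r.map_act, s.map_act]⟩
  have he : ∀ m, e.toLin m = s.toLin (r.toLin m) := fun m => rfl
  refine ⟨r, ?_, fun n => ⟨s.toLin n, hrs n⟩⟩
  rcases hM.eq_zero_or_eq_id e (fun m => by rw [he, he, hrs]) with h | h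
  · obtain ⟨n, hn⟩ := exists_ne (0 : N.carrier)
    refine absurd ?_ hn
    have h1 := h (s.toLin n)
    rw [he, hrs] at h1
    rw [← hrs n, h1, map_zero]
  · exact Function.LeftInverse.injective (g := s.toLin) h

/-- A homomorphism from the parity change of `M` to `N` is one from `M` to the parity change
of `N`. -/
def Hom.ofParityChange {M N : SuperModule k} (f : Hom M.parityChange N) :
    Hom M N.parityChange where
  toLin := f.toLin
  map_gr i m hm := f.map_gr (i + 1) m (by
    change m ∈ M.gr (i + 1 + 1)
    rwa [add_one_add_one])
  map_act := f.map_act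

/-- A homomorphism from `N` to the parity change of `M` is one from the parity change of `N`
to `M`. -/
def Hom.toParityChange {M N : SuperModule k} (f : Hom N M.parityChange) :
    Hom N.parityChange M where
  toLin := f.toLin
  map_gr i m hm := by
    have h : f.toLin m ∈ M.gr (i + 1 + 1) := f.map_gr (i + 1) m hm
    rwa [add_one_add_one] at h
  map_act := f.map_act

theorem IsRetract.of_parityChange {M N : SuperModule k} (h : M.parityChange.IsRetract N) :
    M.IsRetract N.parityChange := by
  obtain ⟨r, s, hrs⟩ := h
  exact ⟨r.ofParityChange, s.toParityChange, hrs⟩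

theorem IsRetract.of_parityChange_parityChange {M N : SuperModule k}
    (h : M.parityChange.IsRetract N.parityChange) : M.IsRetract N := by
  obtain ⟨r, s, hrs⟩ := h
  refine ⟨⟨r.toLin, fun i m hm => ?_, r.map_act⟩, ⟨s.toLin, fun i m hm => ?_, s.map_act⟩, hrs⟩
  · have h : r.toLin m ∈ N.gr (i + 1 + 1) := r.map_gr (i + 1) m (by
      change m ∈ M.gr (i + 1 + 1)
      rwa [add_one_add_one])
    rwa [add_one_add_one] at h
  · have h : s.toLin m ∈ M.gr (i + 1 + 1) := s.map_gr (i + 1) m (by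
      change m ∈ N.gr (i + 1 + 1)
      rwa [add_one_add_one])
    rwa [add_one_add_one] at h

/-- An element of the dual supermodule, as a linear form. -/
abbrev asDual {M : SuperModule k} (φ : M.dual.carrier) : Module.Dual k M.carrier := φ

theorem mem_dual_gr {M : SuperModule k} {i : ZMod 2} {φ : M.dual.carrier} :
    φ ∈ M.dual.gr i ↔ ∀ m ∈ M.gr (i + 1), asDual φ m = 0 :=
  Submodule.mem_dualAnnihilator (asDual φ)

theorem dual_X_apply (M : SuperModule k) (φ : Module.Dual k M.carrier) (m : M.carrier) :
    asDual (M.dual.X φ) m = - φ (M.twist 1 (M.X m)) :=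
  M.dualAct_apply x_mem_part φ m

theorem dual_Y_apply (M : SuperModule k) (φ : Module.Dual k M.carrier) (m : M.carrier) :
    asDual (M.dual.Y φ) m = - φ (M.twist 1 (M.Y m)) :=
  M.dualAct_apply y_mem_part φ m

theorem dual_T (M : SuperModule k) (hT : M.T = 0) : M.dual.T = 0 := by
  refine LinearMap.ext fun φ => LinearMap.ext fun m => ?_
  have h := M.dualAct_apply t_mem_part φ m
  change M.dualAct (t k) φ m = 0
  rw [h]
  change - asDual φ (M.twist 0 (M.T m)) = 0
  rw [hT]; simp

theorem dual_twist_apply (M : SuperModule k) (i : ZMod 2) (φ : Module.Dual k M.carrier)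
    (m : M.carrier) : asDual (M.dual.twist i φ) m = φ (M.twist i m) := by
  have h : M.dual.twist i = Module.Dual.transpose (R := k) (M.twist i) := by
    refine M.dual.end_ext fun j ψ hψ => ?_
    rw [twist_of_mem M.dual i hψ]
    refine M.end_ext fun l m hm => ?_
    change koszul i j • asDual ψ m = asDual ψ (M.twist i m)
    rw [twist_of_mem M i hm, map_zsmul]
    by_cases hjl : l = j
    · rw [hjl]
    · obtain rfl : l = j + 1 := by clear * - hjl; revert l j; decide
      rw [mem_dual_gr.1 hψ m hm, smul_zero, smul_zero]
  rw [h]; rfl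

/-- Duality turns a retraction of `M.dual` onto `N` into one of `M` onto `N.dual`. The canonical
map from `M` to its double dual sends `m` to `φ ↦ φ (± m)`, with the sign `-1` on the odd part. -/
theorem IsRetract.of_dual {M N : SuperModule k} [FiniteDimensional k M.carrier]
    (hMT : M.T = 0) (hNT : N.T = 0) (h : M.dual.IsRetract N) : M.IsRetract N.dual := by
  obtain ⟨r, s, hrs⟩ := h
  let S : N.carrier →ₗ[k] Module.Dual k M.carrier := s.toLin
  let R : Module.Dual k M.carrier →ₗ[k] N.carrier := r.toLin
  have hRS : ∀ n, R (S n) = n := hrs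
  let r₀ : M.carrier →ₗ[k] Module.Dual k N.carrier := S.flip ∘ₗ M.twist 1
  have hr₀ : ∀ m n, r₀ m n = S n (M.twist 1 m) := fun m n => rfl
  let ev := Module.evalEquiv k M.carrier
  let s₀ : Module.Dual k N.carrier →ₗ[k] M.carrier :=
    M.twist 1 ∘ₗ ev.symm.toLinearMap ∘ₗ R.dualMap
  have hs₀ : ∀ (φ : Module.Dual k M.carrier) ψ, φ (M.twist 1 (s₀ ψ)) = ψ (R φ) := fun φ ψ => by
    change φ (M.twist 1 (M.twist 1 (ev.symm (R.dualMap ψ)))) = _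
    rw [twist_twist, Module.apply_evalEquiv_symm_apply]
    rfl
  have hsep : ∀ m m' : M.carrier, (∀ φ : Module.Dual k M.carrier,
      φ (M.twist 1 m) = φ (M.twist 1 m')) → m = m' := fun m m' hm => by
    have h1 : M.twist 1 m = M.twist 1 m' := by
      rw [← sub_eq_zero, ← Module.forall_dual_apply_eq_zero_iff k]
      intro φ
      rw [map_sub, hm, sub_self]
    rw [← M.twist_twist 1 m, h1, twist_twist]
  have hStw : ∀ n m, S n (M.twist 1 m) = S (N.twist 1 n) m := fun n m => by
    have h1 : S (N.twist 1 n) = M.dual.twist 1 (S n) := map_twist s.map_gr 1 n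
    rw [h1, dual_twist_apply]
  have hRtw : ∀ φ : Module.Dual k M.carrier, N.twist 1 (R φ) = R (φ ∘ₗ M.twist 1) := fun φ => by
    have h1 : R (M.dual.twist 1 φ) = N.twist 1 (R φ) := map_twist r.map_gr 1 φ
    rw [← h1]
    congr 1
    exact LinearMap.ext fun m => M.dual_twist_apply 1 φ m
  have hSX : ∀ n m, S (N.X n) m = - S n (M.twist 1 (M.X m)) := fun n m => by
    rw [← dual_X_apply]
    exact LinearMap.congr_fun (show S (N.X n) = asDual (M.dual.X (S n)) from s.map_X n) m
  have hSY : ∀ n m, S (N.Y n) m = - S n (M.twist 1 (M.Y m)) := fun n m => by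
    rw [← dual_Y_apply]
    exact LinearMap.congr_fun (show S (N.Y n) = asDual (M.dual.Y (S n)) from s.map_Y n) m
  have hRX : ∀ φ : Module.Dual k M.carrier, N.X (R φ) = - R (φ ∘ₗ M.twist 1 ∘ₗ M.X) := fun φ => by
    rw [← map_neg]
    refine (r.map_X φ).symm.trans (congrArg R ?_)
    exact LinearMap.ext fun m => M.dual_X_apply φ m
  have hRY : ∀ φ : Module.Dual k M.carrier, N.Y (R φ) = - R (φ ∘ₗ M.twist 1 ∘ₗ M.Y) := fun φ => by
    rw [← map_neg]
    refine (r.map_Y φ).symm.trans (congrArg R ?_)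
    exact LinearMap.ext fun m => M.dual_Y_apply φ m
  have hrX : ∀ m, r₀ (M.X m) = asDual (N.dual.X (r₀ m)) := fun m => by
    refine LinearMap.ext fun n => ?_
    rw [dual_X_apply, hr₀, hr₀, hStw, hStw, twist_twist, hSX, neg_neg, ← hStw]
  have hrY : ∀ m, r₀ (M.Y m) = asDual (N.dual.Y (r₀ m)) := fun m => by
    refine LinearMap.ext fun n => ?_
    rw [dual_Y_apply, hr₀, hr₀, hStw, hStw, twist_twist, hSY, neg_neg, ← hStw]
  have hsX : ∀ ψ : Module.Dual k N.carrier, s₀ (asDual (N.dual.X ψ)) = M.X (s₀ ψ) := fun ψ => by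
    refine hsep _ _ fun φ => ?_
    have h1 := hs₀ ((φ ∘ₗ M.twist 1 ∘ₗ M.X) ∘ₗ M.twist 1) ψ
    rw [LinearMap.comp_apply, twist_twist] at h1
    rw [hs₀, dual_X_apply, hRX, map_neg, map_neg, neg_neg, hRtw]
    exact h1.symm
  have hsY : ∀ ψ : Module.Dual k N.carrier, s₀ (asDual (N.dual.Y ψ)) = M.Y (s₀ ψ) := fun ψ => by
    refine hsep _ _ fun φ => ?_
    have h1 := hs₀ ((φ ∘ₗ M.twist 1 ∘ₗ M.Y) ∘ₗ M.twist 1) ψ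
    rw [LinearMap.comp_apply, twist_twist] at h1
    rw [hs₀, dual_Y_apply, hRY, map_neg, map_neg, neg_neg, hRtw]
    exact h1.symm
  have hsgr : ∀ i (ψ : Module.Dual k N.carrier), (∀ n ∈ N.gr (i + 1), ψ n = 0) →
      s₀ ψ ∈ M.gr i := fun i ψ hψ => by
    refine M.mem_gr_of_proj_eq_zero (hsep _ _ fun φ => ?_)
    have h1 : M.twist 1 (M.proj (i + 1) (s₀ ψ)) = M.proj (i + 1) (M.twist 1 (s₀ ψ)) :=
      map_proj (f := M.twist 1) (fun j m hm => by
        rw [twist_of_mem M 1 hm]; exact zsmul_mem hm _) _ _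
    have h2 : φ ∘ₗ M.proj (i + 1) ∈ M.dual.gr (i + 1) := mem_dual_gr.2 fun m hm => by
      rw [add_one_add_one] at hm
      change φ (M.proj (i + 1) m) = 0
      rw [proj_of_mem M _ hm, if_neg (by clear * -; revert i; decide), map_zero]
    have h3 := hs₀ (φ ∘ₗ M.proj (i + 1)) ψ
    rw [LinearMap.comp_apply] at h3
    rw [h1, map_zero, map_zero, h3]
    exact hψ _ (r.map_gr _ _ h2)
  refine ⟨Hom.mk' (N := N.dual) r₀ (fun i m hm => ?_) (fun m => ?_) hrX hrY,
    Hom.mk' (M := N.dual) s₀ (fun i ψ hψ => hsgr i ψ (mem_dual_gr.1 hψ)) (fun ψ => ?_) hsX hsY, ?_⟩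
  · refine mem_dual_gr.2 fun n hn => ?_
    change r₀ m n = 0
    rw [hr₀, twist_of_mem M 1 hm, map_zsmul]
    have h1 : S n m = 0 := mem_dual_gr.1 (s.map_gr _ n hn) m (by rwa [add_one_add_one])
    rw [h1, smul_zero]
  · rw [hMT, dual_T N hNT]
    exact map_zero r₀
  · rw [hMT, dual_T N hNT]
    exact map_zero s₀
  · exact fun ψ => LinearMap.ext fun n => by
      exact (hs₀ (S n) ψ).trans (by rw [hRS])

/-! ### The supermodules `W_{n,2}` as retracts -/

theorem WAct_x_apply (n : ℕ) (v : (Fin n → k) × (Fin (n - 1) → k)) :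
    WAct k n (x k) v = (0, fun j => v.1 ⟨j.1 + 1, by omega⟩) := by
  simp [WAct, x]

theorem WAct_y_apply (n : ℕ) (v : (Fin n → k) × (Fin (n - 1) → k)) :
    WAct k n (y k) v = (0, fun j => v.1 ⟨j.1, by omega⟩) := by
  simp [WAct, y]

theorem W_T (n : ℕ) : (W k n).T = 0 := by
  have h : ∀ v : (Fin n → k) × (Fin (n - 1) → k), WAct k n (t k) v = 0 := fun v => by
    ext l <;> simp [WAct, t]
  exact LinearMap.ext h

theorem W_nontrivial {n : ℕ} (hn : 1 ≤ n) : Nontrivial (W k n).carrier := by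
  have : Nonempty (Fin n) := ⟨⟨0, hn⟩⟩
  exact inferInstanceAs (Nontrivial ((Fin n → k) × (Fin (n - 1) → k)))

/-- If `x` and `y` annihilate the odd part, then the supermodule is given by a pencil of linear maps
from the even to the odd part, and a minimal pencil that splits off is a copy of `W_{n,2}`. -/
theorem exists_isRetract_W [Infinite k] (M : SuperModule k) [FiniteDimensional k M.carrier]
    (hT : M.T = 0) (hkill : ∀ m ∈ M.gr 1, M.X m = 0 ∧ M.Y m = 0)
    (hdim : Module.finrank k (M.gr 1) ≤ Module.finrank k (M.gr 0))
    (hker : ∀ c : k, ∃ v ∈ M.gr 0, v ≠ 0 ∧ M.X v = c • M.Y v) :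
    ∃ n, 1 ≤ n ∧ M.IsRetract (W k n) := by
  let A : M.gr 0 →ₗ[k] M.gr 1 := (M.X ∘ₗ (M.gr 0).subtype).codRestrict _ (fun m => M.X_mem m.2)
  let B : M.gr 0 →ₗ[k] M.gr 1 := (M.Y ∘ₗ (M.gr 0).subtype).codRestrict _ (fun m => M.Y_mem m.2)
  have hA : ∀ v, (A v : M.carrier) = M.X v := fun v => rfl
  have hB : ∀ v, (B v : M.carrier) = M.Y v := fun v => rfl
  obtain ⟨ε, v, f, g, hv, hgA, hgB, hfv, hgv⟩ := exists_retraction_of_forall_not_injective A B hdim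
    (fun c => by
      obtain ⟨v, hv, hv0, hXY⟩ := hker c
      exact ⟨⟨v, hv⟩, fun h => hv0 (congrArg Subtype.val h), Subtype.ext hXY⟩)
  let p₀ : M.carrier →ₗ[k] M.gr 0 := (M.proj 0).codRestrict _ (M.proj_mem 0)
  let p₁ : M.carrier →ₗ[k] M.gr 1 := (M.proj 1).codRestrict _ (M.proj_mem 1)
  have e2 : (1 + 1 : ZMod 2) = 0 := rfl
  have hp₀X : ∀ m, p₀ (M.X m) = 0 := fun m => Subtype.ext (by
    change M.proj 0 (M.X m) = 0
    rw [proj_X]; exact (hkill _ (M.proj_mem 1 m)).1)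
  have hp₀Y : ∀ m, p₀ (M.Y m) = 0 := fun m => Subtype.ext (by
    change M.proj 0 (M.Y m) = 0
    rw [proj_Y]; exact (hkill _ (M.proj_mem 1 m)).2)
  have hp₁X : ∀ m, p₁ (M.X m) = A (p₀ m) := fun m => Subtype.ext (by
    change M.proj 1 (M.X m) = M.X (M.proj 0 m)
    rw [proj_X, e2])
  have hp₁Y : ∀ m, p₁ (M.Y m) = B (p₀ m) := fun m => Subtype.ext (by
    change M.proj 1 (M.Y m) = M.Y (M.proj 0 m)
    rw [proj_Y, e2])
  have hp₀0 : ∀ m : M.gr 0, p₀ m = m := fun m => Subtype.ext (by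
    change M.proj 0 m = m
    rw [proj_of_mem M 0 m.2, if_pos rfl])
  have hp₀1 : ∀ m : M.gr 1, p₀ m = 0 := fun m => Subtype.ext (by
    change M.proj 0 m = 0
    rw [proj_of_mem M 0 m.2, if_neg (by decide)])
  have hp₁1 : ∀ m : M.gr 1, p₁ m = m := fun m => Subtype.ext (by
    change M.proj 1 m = m
    rw [proj_of_mem M 1 m.2, if_pos rfl])
  have hp₁0 : ∀ m : M.gr 0, p₁ m = 0 := fun m => Subtype.ext (by
    change M.proj 1 m = 0
    rw [proj_of_mem M 1 m.2, if_neg (by decide)])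
  let r : M.carrier →ₗ[k] (Fin (ε + 1) → k) × (Fin (ε + 1 - 1) → k) :=
    (LinearMap.pi fun i => f i.1 ∘ₗ p₀).prod (LinearMap.pi fun j => g j.1 ∘ₗ p₁)
  have hr : ∀ m, r m = (fun i => f i.1 (p₀ m), fun j => g j.1 (p₁ m)) := fun m => rfl
  let s₀ : (Fin (ε + 1) → k) →ₗ[k] M.gr 0 := Fintype.linearCombination k (fun i => v i)
  let s₁ : (Fin (ε + 1 - 1) → k) →ₗ[k] M.gr 1 := Fintype.linearCombination k (fun j => B (v j))
  have hs₀ : ∀ p, s₀ p = ∑ i, p i • v i := fun p => rfl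
  have hs₁ : ∀ q, s₁ q = ∑ j, q j • B (v j) := fun p => rfl
  let s : (Fin (ε + 1) → k) × (Fin (ε + 1 - 1) → k) →ₗ[k] M.carrier :=
    ((M.gr 0).subtype ∘ₗ s₀).coprod ((M.gr 1).subtype ∘ₗ s₁)
  have hs : ∀ p, s p = (s₀ p.1 : M.carrier) + (s₁ p.2 : M.carrier) := fun p => rfl
  have hrX : ∀ m, r (M.X m) = WAct k (ε + 1) (x k) (r m) := fun m => by
    rw [WAct_x_apply, hr, hr, hp₀X, hp₁X]
    refine Prod.ext (funext fun i => map_zero _) (funext fun j => ?_)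
    exact LinearMap.congr_fun (hgA j (by omega)) (p₀ m)
  have hrY : ∀ m, r (M.Y m) = WAct k (ε + 1) (y k) (r m) := fun m => by
    rw [WAct_y_apply, hr, hr, hp₀Y, hp₁Y]
    refine Prod.ext (funext fun i => map_zero _) (funext fun j => ?_)
    exact LinearMap.congr_fun (hgB j (by omega)) (p₀ m)
  have hAs : ∀ p, A (s₀ p) = s₁ (fun j => p ⟨j.1 + 1, by omega⟩) := fun p => by
    rw [hs₀, hs₁, map_sum, Fin.sum_univ_succ, map_smul]
    change p 0 • A (v 0) + _ = _
    rw [hv.zero, smul_zero, zero_add]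
    refine Finset.sum_congr rfl fun j _ => ?_
    rw [map_smul]
    exact congrArg (p j.succ • ·) (hv.succ j)
  have hBs : ∀ p, B (s₀ p) = s₁ (fun j => p ⟨j.1, by omega⟩) := fun p => by
    rw [hs₀, hs₁, map_sum, Fin.sum_univ_castSucc, map_smul]
    change _ + p (Fin.last ε) • B (v ε) = _
    rw [← hv.succ, hv.eq_zero _ (Nat.lt_succ_self ε), map_zero, smul_zero, add_zero]
    refine Finset.sum_congr rfl fun j _ => ?_
    rw [map_smul]
    rfl
  have hsX : ∀ p, s (WAct k (ε + 1) (x k) p) = M.X (s p) := fun p => by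
    rw [WAct_x_apply, hs, hs, map_zero, map_add, (hkill _ (s₁ p.2).2).1, add_zero, ← hA, hAs]
    simp
  have hsY : ∀ p, s (WAct k (ε + 1) (y k) p) = M.Y (s p) := fun p => by
    rw [WAct_y_apply, hs, hs, map_zero, map_add, (hkill _ (s₁ p.2).2).2, add_zero, ← hB, hBs]
    simp
  have hrs : ∀ p, r (s p) = p := fun p => by
    rw [hr, hs, map_add, map_add, hp₀0, hp₀1, hp₁0, hp₁1, add_zero, zero_add, hs₀, hs₁]
    refine Prod.ext (funext fun i => ?_) (funext fun j => ?_)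
    · simp only [map_sum, map_smul]
      rw [Finset.sum_eq_single i]
      · rw [hfv i (by omega) i (by omega), if_pos rfl]; simp
      · intro i' _ hi'
        rw [hfv i (by omega) i' (by omega), if_neg (fun h => hi' (Fin.ext h.symm)), smul_zero]
      · simp
    · simp only [map_sum, map_smul]
      rw [Finset.sum_eq_single j]
      · rw [hgv j (by omega) j (by omega), if_pos rfl]; simp
      · intro i' _ hi'
        rw [hgv j (by omega) i' (by omega), if_neg (fun h => hi' (Fin.ext h.symm)), smul_zero]
      · simp
  have hrgr : ∀ i, ∀ m ∈ M.gr i, r m ∈ (W k (ε + 1)).gr i := by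
    intro i m hm
    rcases parity_cases i with rfl | rfl
    · refine ⟨trivial, (Submodule.mem_bot k).2 ?_⟩
      rw [hr, hp₁0 ⟨m, hm⟩]
      exact funext fun j => map_zero _
    · refine ⟨(Submodule.mem_bot k).2 ?_, trivial⟩
      rw [hr, hp₀1 ⟨m, hm⟩]
      exact funext fun j => map_zero _
  have hsgr : ∀ i, ∀ p ∈ (W k (ε + 1)).gr i, s p ∈ M.gr i := by
    intro i p hp
    rcases parity_cases i with rfl | rfl
    · obtain ⟨p₁, p₂⟩ := p
      obtain rfl : p₂ = 0 := (Submodule.mem_bot k).1 hp.2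
      have h := hs (p₁, 0)
      rw [map_zero, Submodule.coe_zero, add_zero] at h
      exact h ▸ (s₀ p₁).2
    · obtain ⟨p₁, p₂⟩ := p
      obtain rfl : p₁ = 0 := (Submodule.mem_bot k).1 hp.1
      have h := hs (0, p₂)
      rw [map_zero, Submodule.coe_zero, zero_add] at h
      exact h ▸ (s₁ p₂).2
  exact ⟨ε + 1, by omega,
    Hom.mk' (N := W k (ε + 1)) r hrgr (fun m => by rw [hT, W_T]; exact map_zero r) hrX hrY,
    Hom.mk' (M := W k (ε + 1)) s hsgr (fun m => by rw [hT, W_T]; exact map_zero s) hsX hsY, hrs⟩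

/-! ### Jordan types and ranks -/

theorem HasJordanTypeAt.finrank_eq {M : SuperModule k} {z : sl11 k} {a₁ a₂ : ℕ}
    (h : M.HasJordanTypeAt z a₁ a₂) : Module.finrank k M.carrier = a₁ + 2 * a₂ := by
  obtain ⟨b, -⟩ := h
  rw [Module.finrank_eq_card_basis b]
  simp; omega

theorem HasJordanTypeAt.act_act {M : SuperModule k} {z : sl11 k} {a₁ a₂ : ℕ}
    (h : M.HasJordanTypeAt z a₁ a₂) (m : M.carrier) : M.act z (M.act z m) = 0 := by
  obtain ⟨b, -, h1, h2, h3⟩ := h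
  have : M.act z ∘ₗ M.act z = 0 := b.ext fun i => by
    rcases i with i | i | i
    · simp [h1]
    · simp [h2, h3]
    · simp [h3]
  exact LinearMap.congr_fun this m

theorem HasJordanTypeAt.finrank_range {M : SuperModule k} {z : sl11 k} {a₁ a₂ : ℕ}
    (h : M.HasJordanTypeAt z a₁ a₂) : Module.finrank k (LinearMap.range (M.act z)) = a₂ := by
  obtain ⟨b, -, h1, h2, h3⟩ := h
  have hr : LinearMap.range (M.act z) =
      Submodule.span k (Set.range fun j => b (Sum.inr (Sum.inr j))) := by
    rw [LinearMap.range_eq_map, ← b.span_eq, Submodule.map_span, ← Set.range_comp]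
    refine le_antisymm (Submodule.span_le.2 ?_) (Submodule.span_mono ?_)
    · rintro _ ⟨i | i | i, rfl⟩
      · simp [h1]
      · rw [Function.comp_apply, h2]
        exact Submodule.subset_span ⟨i, rfl⟩
      · simp [h3]
    · rintro _ ⟨j, rfl⟩
      exact ⟨Sum.inr (Sum.inl j), h2 j⟩
  rw [hr]
  exact (finrank_span_eq_card (b.linearIndependent.comp (fun j => Sum.inr (Sum.inr j))
    fun i j hij => by simpa using hij)).trans (by simp)

/-- If the square of `x + y` vanishes, then so does `t`, as `[x + y, x + y] = 2 t`. -/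
theorem HasStrongConstantJordanType.T_eq_zero [CharZero k] {M : SuperModule k} {a₁ a₂ : ℕ}
    (h : M.HasStrongConstantJordanType a₁ a₂) : M.T = 0 := by
  refine LinearMap.ext fun m => ?_
  have h1 := (h ((1 : k) • x k + (1 : k) • y k) (smul_x_add_smul_y_mem_part _ _)
    (smul_x_add_smul_y_ne_zero (Or.inl one_ne_zero))).act_act m
  rw [act_odd, act_odd] at h1
  simpa [X_X, Y_Y, Y_X_eq] using h1

theorem IsIso.finrank_eq {M N : SuperModule k} (h : M.IsIso N) :
    Module.finrank k M.carrier = Module.finrank k N.carrier := by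
  obtain ⟨f, hf⟩ := h
  exact (LinearEquiv.ofBijective f.toLin hf).finrank_eq

theorem IsIso.finrank_range_X {M N : SuperModule k} (h : M.IsIso N) :
    Module.finrank k (LinearMap.range M.X) = Module.finrank k (LinearMap.range N.X) := by
  obtain ⟨f, hf⟩ := h
  have h1 : LinearMap.range N.X = (LinearMap.range M.X).map f.toLin := by
    rw [← LinearMap.range_comp, show f.toLin ∘ₗ M.X = N.X ∘ₗ f.toLin from LinearMap.ext f.map_X,
      LinearMap.range_comp_of_range_eq_top _ (LinearMap.range_eq_top.2 hf.2)]
  rw [h1]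
  exact ((LinearEquiv.ofBijective f.toLin hf).finrank_map_eq _).symm

instance dual_finiteDimensional (M : SuperModule k) [FiniteDimensional k M.carrier] :
    FiniteDimensional k M.dual.carrier :=
  inferInstanceAs (FiniteDimensional k (Module.Dual k M.carrier))

theorem finrank_dual (M : SuperModule k) :
    Module.finrank k M.dual.carrier = Module.finrank k M.carrier :=
  Subspace.dual_finrank_eq

theorem finrank_range_dual_X (M : SuperModule k) [FiniteDimensional k M.carrier] :
    Module.finrank k (LinearMap.range M.dual.X) = Module.finrank k (LinearMap.range M.X) := by
  have h1 : M.dual.X = - (M.twist 1 ∘ₗ M.X).dualMap :=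
    LinearMap.ext fun φ => LinearMap.ext fun m => M.dual_X_apply φ m
  let e : M.carrier ≃ₗ[k] M.carrier := LinearEquiv.ofInvolutive (M.twist 1) (M.twist_twist 1)
  have h2 : Module.finrank k (LinearMap.range (M.twist 1 ∘ₗ M.X).dualMap) =
      Module.finrank k (LinearMap.range M.X) := by
    rw [LinearMap.finrank_range_dualMap_eq_finrank_range, LinearMap.range_comp]
    exact e.finrank_map_eq _
  rw [← LinearMap.range_neg] at h2
  exact (congrArg (fun f : Module.End k (Module.Dual k M.carrier) =>
    Module.finrank k (LinearMap.range f)) h1).trans h2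

instance W_finiteDimensional (n : ℕ) : FiniteDimensional k (W k n).carrier :=
  inferInstanceAs (FiniteDimensional k ((Fin n → k) × (Fin (n - 1) → k)))

theorem finrank_W (n : ℕ) : Module.finrank k (W k n).carrier = n + (n - 1) := by
  change Module.finrank k ((Fin n → k) × (Fin (n - 1) → k)) = _
  simp

theorem finrank_range_W_X (n : ℕ) : Module.finrank k (LinearMap.range (W k n).X) = n - 1 := by
  change Module.finrank k (LinearMap.range (WAct k n (x k))) = _
  have h : LinearMap.range (WAct k n (x k)) =
      LinearMap.range (LinearMap.inr k (Fin n → k) (Fin (n - 1) → k)) := by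
    refine le_antisymm ?_ ?_
    · rintro _ ⟨v, rfl⟩
      exact ⟨_, (WAct_x_apply n v).symm⟩
    · rintro _ ⟨q, rfl⟩
      refine ⟨(fun i => if h : 0 < i.1 then q ⟨i.1 - 1, by omega⟩ else 0, 0), ?_⟩
      rw [WAct_x_apply]
      simp
  rw [h, LinearMap.finrank_range_of_inj LinearMap.inr_injective]
  simp

/-! ### The classification -/

theorem gr_dual_finrank (M : SuperModule k) [FiniteDimensional k M.carrier] (i : ZMod 2) :
    Module.finrank k (M.dual.gr i) = Module.finrank k (M.gr i) := by
  have h1 : Module.finrank k (M.gr i) + Module.finrank k (M.gr (i + 1)) =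
      Module.finrank k M.carrier := by
    rcases parity_cases i with rfl | rfl
    · exact Submodule.finrank_add_eq_of_isCompl M.isCompl_gr
    · exact Submodule.finrank_add_eq_of_isCompl M.isCompl_gr.symm
  have h2 : Module.finrank k (M.gr (i + 1)) + Module.finrank k (M.dual.gr i) =
      Module.finrank k M.carrier := Subspace.finrank_add_finrank_dualAnnihilator_eq (M.gr (i + 1))
  omega

theorem exists_ker_of_finrank_lt (M : SuperModule k) [FiniteDimensional k M.carrier]
    (hdim : Module.finrank k (M.gr 1) < Module.finrank k (M.gr 0)) (c : k) :
    ∃ v ∈ M.gr 0, v ≠ 0 ∧ M.X v = c • M.Y v := by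
  let f : M.gr 0 →ₗ[k] M.gr 1 := (M.X - c • M.Y).restrict
    fun m hm => sub_mem (M.X_mem hm) (Submodule.smul_mem _ _ (M.Y_mem hm))
  obtain ⟨v, hv, hv0⟩ := Submodule.exists_mem_ne_zero_of_ne_bot
    (LinearMap.ker_ne_bot_of_finrank_lt (f := f) hdim)
  refine ⟨v, v.2, fun h => hv0 (Subtype.ext h), sub_eq_zero.1 ?_⟩
  exact congrArg Subtype.val (LinearMap.mem_ker.1 hv)

/-- The constant rank condition enters here: a pencil of square matrices over an algebraically
closed field has a singular member, so that all of its members are singular. -/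
theorem exists_ker_of_constant_rank [IsAlgClosed k] (M : SuperModule k)
    [FiniteDimensional k M.carrier] (hkill : ∀ m ∈ M.gr 1, M.X m = 0 ∧ M.Y m = 0)
    (hdim : Module.finrank k (M.gr 1) ≤ Module.finrank k (M.gr 0))
    [Nontrivial M.carrier] {r : ℕ}
    (hr : ∀ z ∈ part k 1, z ≠ 0 → Module.finrank k (LinearMap.range (M.act z)) = r) (c : k) :
    ∃ v ∈ M.gr 0, v ≠ 0 ∧ M.X v = c • M.Y v := by
  rcases hdim.lt_or_eq with hlt | heq
  · exact M.exists_ker_of_finrank_lt hlt c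
  suffices h : ∃ v ∈ M.gr 0, v ≠ 0 ∧ M.act ((1 : k) • x k + (-c) • y k) v = 0 by
    obtain ⟨v, hv, hv0, h⟩ := h
    refine ⟨v, hv, hv0, ?_⟩
    rw [act_odd, one_smul, neg_smul] at h
    exact sub_eq_zero.1 (by rw [sub_eq_add_neg]; exact h)
  -- the rank of a member of the pencil
  have hrank : ∀ a b : k, (a ≠ 0 ∨ b ≠ 0) → r + Module.finrank k (LinearMap.ker
      (M.act (a • x k + b • y k) ∘ₗ (M.gr 0).subtype)) = Module.finrank k (M.gr 0) := by
    intro a b hab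
    rw [← hr _ (smul_x_add_smul_y_mem_part a b) (smul_x_add_smul_y_ne_zero hab),
      ← LinearMap.finrank_range_add_finrank_ker
        (M.act (a • x k + b • y k) ∘ₗ (M.gr 0).subtype)]
    refine congrArg (· + _) ?_
    refine congrArg (fun p : Submodule k M.carrier => Module.finrank k p) (le_antisymm ?_ ?_)
    · rintro _ ⟨m, rfl⟩
      refine ⟨⟨M.proj 0 m, M.proj_mem 0 m⟩, ?_⟩
      have h1 := hkill _ (M.proj_mem 1 m)
      conv_rhs => rw [← M.proj_add_proj m, map_add, act_odd _ _ _ (M.proj 1 m), h1.1, h1.2]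
      simp
    · exact LinearMap.range_comp_le_range _ _
  have hker : ∀ a b : k, (∃ v ∈ M.gr 0, v ≠ 0 ∧ M.act (a • x k + b • y k) v = 0) ↔ 0 <
      Module.finrank k (LinearMap.ker (M.act (a • x k + b • y k) ∘ₗ (M.gr 0).subtype)) := by
    intro a b
    rw [Module.finrank_pos_iff_exists_ne_zero]
    constructor
    · rintro ⟨v, hv, hv0, h⟩
      exact ⟨⟨⟨v, hv⟩, h⟩, fun h' => hv0 (congrArg (fun w => (w.1.1 : M.carrier)) h')⟩
    · rintro ⟨⟨⟨v, hv⟩, h⟩, h'⟩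
      refine ⟨v, hv, fun hv0 => h' ?_, h⟩
      subst hv0; rfl
  -- some member of the pencil is singular
  have hsing : ∃ a b : k, (a ≠ 0 ∨ b ≠ 0) ∧
      ∃ v ∈ M.gr 0, v ≠ 0 ∧ M.act (a • x k + b • y k) v = 0 := by
    let A : M.gr 0 →ₗ[k] M.gr 1 := M.X.restrict fun m => M.X_mem
    let B : M.gr 0 →ₗ[k] M.gr 1 := M.Y.restrict fun m => M.Y_mem
    by_cases hB : Function.Injective B
    · have hnt : Nontrivial (M.gr 0) := by
        by_contra hnt
        rw [not_nontrivial_iff_subsingleton] at hnt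
        have h0 := Module.finrank_zero_of_subsingleton (R := k) (M := M.gr 0)
        have h1 := Submodule.finrank_add_eq_of_isCompl M.isCompl_gr
        have h2 := Module.finrank_pos (R := k) (M := M.carrier)
        omega
      let e := LinearEquiv.ofInjectiveOfFinrankEq B hB heq.symm
      obtain ⟨c, hc⟩ := Module.End.exists_eigenvalue (e.symm.toLinearMap ∘ₗ A)
      obtain ⟨v, hv⟩ := hc.exists_hasEigenvector
      refine ⟨1, -c, Or.inl one_ne_zero, v, v.2, fun h => hv.2 (Subtype.ext h), ?_⟩
      have h1 : A v = c • B v := by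
        have h2 := congrArg e hv.apply_eq_smul
        rw [LinearMap.comp_apply, LinearEquiv.coe_coe, e.apply_symm_apply, map_smul] at h2
        exact h2
      have h3 : M.X v = c • M.Y v := congrArg Subtype.val h1
      rw [act_odd, h3]; simp
    · rw [← LinearMap.ker_eq_bot] at hB
      obtain ⟨v, hv, hv0⟩ := Submodule.exists_mem_ne_zero_of_ne_bot hB
      refine ⟨0, 1, Or.inr one_ne_zero, v, v.2, fun h => hv0 (Subtype.ext h), ?_⟩
      have h3 : M.Y v = 0 := congrArg Subtype.val (LinearMap.mem_ker.1 hv)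
      rw [act_odd, h3]; simp
  obtain ⟨a, b, hab, h⟩ := hsing
  rw [hker] at h ⊢
  have h1 := hrank a b hab
  have h2 := hrank 1 (-c) (Or.inl one_ne_zero)
  omega

/-- If `x` and `y` annihilate the even part and it is larger than the odd part, then the
dual supermodule is given by a pencil with more columns than rows. -/
theorem exists_isRetract_dual_W [Infinite k] (M : SuperModule k) [FiniteDimensional k M.carrier]
    (hT : M.T = 0) (hkill : ∀ m ∈ M.gr 0, M.X m = 0 ∧ M.Y m = 0)
    (hdim : Module.finrank k (M.gr 1) < Module.finrank k (M.gr 0)) :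
    ∃ n, 1 ≤ n ∧ M.IsRetract (W k n).dual := by
  have hdim' : Module.finrank k (M.dual.gr 1) < Module.finrank k (M.dual.gr 0) := by
    rw [gr_dual_finrank, gr_dual_finrank]
    exact hdim
  have hsq : ∀ (Z : Module.End k M.carrier), (∀ m ∈ M.gr 1, Z m ∈ M.gr (1 + 1)) →
      (∀ m ∈ M.gr 0, Z m = 0) → ∀ m, M.twist 1 (Z m) ∈ M.gr 0 := fun Z h0 h1 m => by
    have h2 : Z m ∈ M.gr 0 := by
      rw [← M.proj_add_proj m, map_add, h1 _ (M.proj_mem 0 m), zero_add]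
      exact h0 _ (M.proj_mem 1 m)
    rw [twist_of_mem M 1 h2]
    exact zsmul_mem h2 _
  have hkill' : ∀ φ ∈ M.dual.gr 1, M.dual.X φ = 0 ∧ M.dual.Y φ = 0 := by
    intro φ hφ
    have hφ' : ∀ m ∈ M.gr 0, asDual φ m = 0 := mem_dual_gr.1 hφ
    constructor
    · refine LinearMap.ext fun m => (M.dual_X_apply φ m).trans ?_
      rw [hφ' _ (hsq M.X (fun m => M.X_mem) (fun m hm => (hkill m hm).1) m), neg_zero]
      rfl
    · refine LinearMap.ext fun m => (M.dual_Y_apply φ m).trans ?_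
      rw [hφ' _ (hsq M.Y (fun m => M.Y_mem) (fun m hm => (hkill m hm).2) m), neg_zero]
      rfl
  have hker := M.dual.exists_ker_of_finrank_lt hdim'
  obtain ⟨n, hn, h⟩ := M.dual.exists_isRetract_W (dual_T M hT) hkill' hdim'.le hker
  exact ⟨n, hn, h.of_dual hT (W_T n)⟩

/-- The two cases of the classification when `x` and `y` annihilate the odd part: if the odd part
is at most as large as the even part, the pencil has a kernel, and otherwise its dual does. -/
theorem exists_isRetract [IsAlgClosed k] (M : SuperModule k)
    [FiniteDimensional k M.carrier] [Nontrivial M.carrier] (hT : M.T = 0)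
    (hkill : ∀ m ∈ M.gr 1, M.X m = 0 ∧ M.Y m = 0) {r : ℕ}
    (hr : ∀ z ∈ part k 1, z ≠ 0 → Module.finrank k (LinearMap.range (M.act z)) = r) :
    ∃ n, 1 ≤ n ∧ (M.IsRetract (W k n) ∨ M.IsRetract (W k n).dual.parityChange) := by
  rcases le_or_gt (Module.finrank k (M.gr 1)) (Module.finrank k (M.gr 0)) with hdim | hdim
  · obtain ⟨n, hn, h⟩ := M.exists_isRetract_W hT hkill hdim
      (M.exists_ker_of_constant_rank hkill hdim hr)
    exact ⟨n, hn, Or.inl h⟩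
  · have hfd : FiniteDimensional k M.parityChange.carrier :=
      inferInstanceAs (FiniteDimensional k M.carrier)
    obtain ⟨n, hn, h⟩ := M.parityChange.exists_isRetract_dual_W hT hkill hdim
    exact ⟨n, hn, Or.inr h.of_parityChange⟩

/-- The classification of the indecomposable supermodules of constant rank. -/
theorem Indecomposable.exists_isIso [IsAlgClosed k] [CharZero k] {M : SuperModule k}
    (hM : M.Indecomposable) [FiniteDimensional k M.carrier] (hT : M.T = 0)
    (hproj : ¬ M.IsProjective) {r : ℕ}
    (hr : ∀ z ∈ part k 1, z ≠ 0 → Module.finrank k (LinearMap.range (M.act z)) = r) :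
    ∃ n : ℕ, 1 ≤ n ∧
      (M.IsIso (W k n) ∨ M.IsIso (W k n).parityChange ∨
        M.IsIso (W k n).dual ∨ M.IsIso (W k n).dual.parityChange) := by
  have hnt := hM.1
  have hWd : ∀ n, 1 ≤ n → Nontrivial (W k n).dual.carrier := fun n hn => by
    have := W_nontrivial (k := k) hn
    exact inferInstanceAs (Nontrivial (Module.Dual k (W k n).carrier))
  obtain ⟨i, hi⟩ := hM.exists_parity hT (hM.X_Y_eq_zero hT hproj)
  rcases parity_cases i with rfl | rfl
  · have hfd : FiniteDimensional k M.parityChange.carrier :=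
      inferInstanceAs (FiniteDimensional k M.carrier)
    have hnt' : Nontrivial M.parityChange.carrier := hnt
    obtain ⟨n, hn, h | h⟩ := M.parityChange.exists_isRetract hT hi hr
    · exact ⟨n, hn, Or.inr (Or.inl (h.of_parityChange.isIso hM (W_nontrivial hn)))⟩
    · exact ⟨n, hn, Or.inr (Or.inr (Or.inl
        (h.of_parityChange_parityChange.isIso hM (hWd n hn))))⟩
  · obtain ⟨n, hn, h | h⟩ := M.exists_isRetract hT hi hr
    · exact ⟨n, hn, Or.inl (h.isIso hM (W_nontrivial hn))⟩
    · exact ⟨n, hn, Or.inr (Or.inr (Or.inr (h.isIso hM (hWd n hn))))⟩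

/-- The dimension `a₁ + 2 a₂` and the rank `a₂` of `x` are `2 n - 1` and `n - 1`. -/
theorem HasStrongConstantJordanType.eq_one {M : SuperModule k} {a₁ a₂ : ℕ}
    (hM : M.HasStrongConstantJordanType a₁ a₂) {n : ℕ} (hn : 1 ≤ n)
    (h : M.IsIso (W k n) ∨ M.IsIso (W k n).parityChange ∨
        M.IsIso (W k n).dual ∨ M.IsIso (W k n).dual.parityChange) : a₁ = 1 := by
  have hx : x k ≠ 0 := by
    have := smul_x_add_smul_y_ne_zero (k := k) (a := 1) (b := 0) (Or.inl one_ne_zero)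
    simpa using this
  have h1 := (hM _ x_mem_part hx).finrank_eq
  have h2 := (hM _ x_mem_part hx).finrank_range
  have key : ∀ N : SuperModule k, M.IsIso N → Module.finrank k N.carrier = n + (n - 1) →
      Module.finrank k (LinearMap.range N.X) = n - 1 → a₁ = 1 := fun N h h3 h4 => by
    have h5 := h.finrank_eq
    have h6 := h.finrank_range_X
    change Module.finrank k (LinearMap.range M.X) = a₂ at h2
    omega
  rcases h with h | h | h | h
  · exact key _ h (finrank_W n) (finrank_range_W_X n)
  · exact key _ h (finrank_W n) (finrank_range_W_X n)
  · exact key _ h ((finrank_dual _).trans (finrank_W n))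
      ((finrank_range_dual_X _).trans (finrank_range_W_X n))
  · exact key _ h ((finrank_dual _).trans (finrank_W n))
      ((finrank_range_dual_X _).trans (finrank_range_W_X n))

/-! ### Splitting off the even trivial supermodule -/

/-- A subsupermodule as a supermodule. -/
def ofSub (M : SuperModule k) (S : Submodule k M.carrier) (hS : M.IsSub S) : SuperModule k where
  carrier := S
  gr i := (M.gr i).comap S.subtype
  isCompl_gr := by
    constructor
    · rw [Submodule.disjoint_def]
      intro m h0 h1
      exact Subtype.ext (Submodule.disjoint_def.1 M.isCompl_gr.disjoint _ h0 h1)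
    · rw [codisjoint_iff, eq_top_iff]
      rintro ⟨m, hm⟩ -
      have hm' := hm
      rw [hS.1] at hm'
      obtain ⟨a, ha, b, hb, rfl⟩ := Submodule.mem_sup.1 hm'
      exact Submodule.mem_sup.2 ⟨⟨a, ha.1⟩, ha.2, ⟨b, hb.1⟩, hb.2, rfl⟩
  act :=
    { toFun := fun A => (M.act A).restrict (hS.2 A)
      map_add' := fun A B => by ext; simp
      map_smul' := fun c A => by ext; simp }
  act_mem i j A m hA hm := M.act_mem i j A m hA hm
  act_bracket i j A B hA hB := by
    refine LinearMap.ext fun m => Subtype.ext ?_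
    have h := LinearMap.congr_fun (M.act_bracket i j A B hA hB) m
    simpa using h

/-- An invariant even vector on which a homomorphism to the even trivial supermodule does not vanish
splits off. -/
theorem isIso_directSum_of_apply_eq_one (N : SuperModule k) (f : Hom N (trivialEven k))
    (e : N.carrier) (he : e ∈ N.gr 0) (hact : ∀ A, N.act A e = 0) (h1 : f.toLin e = (1 : k)) :
    N.IsIso ((trivialEven k).directSum (N.ofSub (LinearMap.ker f.toLin) (isSub_ker f))) := by
  let F : N.carrier →ₗ[k] k := f.toLin
  have hF : ∀ A m, F (N.act A m) = 0 := fun A m => f.map_act A m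
  have hF1 : F e = 1 := h1
  let q : N.carrier →ₗ[k] LinearMap.ker F :=
    (LinearMap.id - F.smulRight e).codRestrict _ (fun m => by
      rw [LinearMap.mem_ker]
      change F (m - F m • e) = 0
      rw [map_sub, map_smul, hF1, smul_eq_mul, mul_one, sub_self])
  refine ⟨⟨F.prod q, fun i m hm => ⟨f.map_gr i m hm, ?_⟩, fun A m => ?_⟩, ?_, ?_⟩
  · change m - F m • e ∈ N.gr i
    rcases parity_cases i with rfl | rfl
    · exact sub_mem hm (Submodule.smul_mem _ _ he)
    · have h0 : F m = 0 := (Submodule.mem_bot k).1 (f.map_gr 1 m hm)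
      rw [h0, zero_smul, sub_zero]
      exact hm
  · refine Prod.ext (hF A m) (Subtype.ext ?_)
    change N.act A m - F (N.act A m) • e = N.act A (m - F m • e)
    rw [hF, map_sub, map_smul, hact, zero_smul, smul_zero]
  · refine (injective_iff_map_eq_zero (F.prod q)).2 fun m hm => ?_
    have h2 : F m = 0 := congrArg Prod.fst hm
    have h3 : m - F m • e = 0 := congrArg (fun p => (p.2 : N.carrier)) hm
    rwa [h2, zero_smul, sub_zero] at h3
  · rintro ⟨(c : k), ⟨m, hm⟩⟩
    have hm' : F m = 0 := hm
    have h2 : F (c • e + m) = c := by rw [map_add, map_smul, hF1, hm', smul_eq_mul]; ring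
    refine ⟨c • e + m, Prod.ext h2 (Subtype.ext ?_)⟩
    change (c • e + m) - F (c • e + m) • e = m
    rw [h2, add_sub_cancel_left]

/-! ### Supercommutators with an odd element of Jordan type `[1] + a₂[2]` -/

/-- The algebra behind the exactness of the supercommutator complex: `h` is a contracting homotopy
for `z` up to the projection `p`, and `τ` is the parity operator, so that
`f ↦ z * f - τ * f * τ * z` is the supercommutator with the odd element `z`. -/
theorem eq_supercommutator_add {R : Type*} [Ring R] {τ z h p f : R} (hτ : τ * τ = 1)
    (hτz : τ * z = -(z * τ)) (hτh : τ * h = -(h * τ)) (hτp : τ * p = p * τ)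
    (hzh : z * h + h * z + p = 1) (hzp : z * p = 0) (hpz : p * z = 0)
    (hf : z * f - τ * f * τ * z = 0) :
    f = (z * (h * f + p * (τ * f * τ) * h) - τ * (h * f + p * (τ * f * τ) * h) * τ * z)
      + p * f * p := by
  set s := τ * f * τ with hs
  have hf' : z * f = s * z := sub_eq_zero.1 hf
  have hsf : τ * s * τ = f := by
    rw [hs, show τ * (τ * f * τ) * τ = (τ * τ) * f * (τ * τ) by noncomm_ring, hτ, one_mul, mul_one]
  have hzs : z * s = f * z := by
    calc z * s = (z * τ) * f * τ := by rw [hs]; noncomm_ring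
      _ = -(τ * (z * f) * τ) := by rw [← neg_eq_iff_eq_neg.2 hτz]; noncomm_ring
      _ = -(τ * s * (z * τ)) := by rw [hf']; noncomm_ring
      _ = (τ * s * τ) * z := by rw [← neg_eq_iff_eq_neg.2 hτz]; noncomm_ring
      _ = f * z := by rw [hsf]
  have hτ1 : τ * (h * f) * τ = -(h * s) := by
    rw [show τ * (h * f) * τ = (τ * h) * f * τ by noncomm_ring, hτh, hs]
    noncomm_ring
  have hτ2 : τ * (p * s * h) * τ = -(p * f * h) := by
    rw [show τ * (p * s * h) * τ = (τ * p) * s * h * τ by noncomm_ring, hτp,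
      show p * τ * s * h * τ = p * τ * s * (h * τ) by noncomm_ring,
      ← neg_eq_iff_eq_neg.2 hτh, ← hsf]
    noncomm_ring
  rw [show τ * (h * f + p * s * h) * τ = τ * (h * f) * τ + τ * (p * s * h) * τ by noncomm_ring,
    hτ1, hτ2]
  have e1 : z * (h * f + p * s * h) - (-(h * s) + -(p * f * h)) * z + p * f * p =
      (z * h) * f + (z * p) * s * h + h * (s * z) + p * f * (h * z) + p * f * p := by noncomm_ring
  rw [e1, ← hf', hzp, show h * z = 1 - p - z * h by rw [← hzh]; abel]
  have e2 : z * h * f + 0 * s * h + h * (z * f) + p * f * (1 - p - z * h) + p * f * p =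
      (z * h + h * z) * f + p * f - p * (f * z) * h := by noncomm_ring
  rw [e2, ← hzs, show z * h + h * z = 1 - p by rw [← hzh]; abel,
    show p * (z * s) * h = (p * z) * s * h by noncomm_ring, hpz]
  noncomm_ring

/-- The data extracted from the Jordan type `[1] + a₂[2]` at `z`. -/
theorem HasJordanTypeAt.exists_homotopy {M : SuperModule k} {z : sl11 k} (hz : z ∈ part k 1)
    {a₂ : ℕ} (hM : M.HasJordanTypeAt z 1 a₂) :
    ∃ (h : Module.End k M.carrier) (v : M.carrier) (φ : Module.Dual k M.carrier) (i : ZMod 2),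
      v ∈ M.gr i ∧ φ v = 1 ∧ M.act z v = 0 ∧ (∀ m, φ (M.act z m) = 0) ∧
      (∀ m, φ (M.twist 1 m) = koszul 1 i • φ m) ∧ M.twist 1 * h = -(h * M.twist 1) ∧
      M.act z * h + h * M.act z + φ.smulRight v = 1 := by
  obtain ⟨b, hb, h1, h2, h3⟩ := hM
  have hb' : ∀ i, ∃ l, b i ∈ M.gr l := fun i => (hb i).elim (fun h => ⟨0, h⟩) fun h => ⟨1, h⟩
  obtain ⟨l, hl⟩ := hb' (Sum.inl 0)
  let h : Module.End k M.carrier :=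
    b.constr k (Sum.elim 0 (Sum.elim 0 fun j => b (Sum.inr (Sum.inl j))))
  have hh1 : ∀ i, h (b (Sum.inl i)) = 0 := fun i => by simp [h]
  have hh2 : ∀ i, h (b (Sum.inr (Sum.inl i))) = 0 := fun i => by
    simp [h]
  have hh3 : ∀ i, h (b (Sum.inr (Sum.inr i))) = b (Sum.inr (Sum.inl i)) := fun i => by
    simp [h]
  refine ⟨h, b (Sum.inl 0), b.coord (Sum.inl 0), l, hl, by simp, h1 0, fun m => ?_, fun m => ?_,
    ?_, ?_⟩
  · have : b.coord (Sum.inl 0) ∘ₗ M.act z = 0 := b.ext fun i => by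
      rcases i with i | i | i
      · simp [h1]
      · simp [h2]
      · simp [h3]
    exact LinearMap.congr_fun this m
  · have : b.coord (Sum.inl 0) ∘ₗ M.twist 1 = koszul 1 l • b.coord (Sum.inl 0) :=
      b.ext fun i => by
        obtain ⟨l', hl'⟩ := hb' i
        rw [LinearMap.comp_apply, twist_of_mem M 1 hl', map_zsmul, LinearMap.smul_apply]
        by_cases hi : i = Sum.inl 0
        · subst hi
          have h4 := (twist_of_mem M 1 hl').symm.trans (twist_of_mem M 1 hl)
          have h5 := congrArg (b.coord (Sum.inl 0)) h4
          rwa [map_zsmul, map_zsmul] at h5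
        · simp [hi]
    exact LinearMap.congr_fun this m
  · refine b.ext fun i => ?_
    rw [Module.End.mul_apply, LinearMap.neg_apply, Module.End.mul_apply]
    rcases i with i | i | j
    · obtain ⟨l', hl'⟩ := hb' (Sum.inl i)
      rw [twist_of_mem M 1 hl', map_zsmul, hh1]; simp
    · obtain ⟨l', hl'⟩ := hb' (Sum.inr (Sum.inl i))
      rw [twist_of_mem M 1 hl', map_zsmul, hh2]; simp
    · obtain ⟨l', hl'⟩ := hb' (Sum.inr (Sum.inl j))
      have h4 : b (Sum.inr (Sum.inr j)) ∈ M.gr (1 + l') := by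
        rw [← h2]; exact M.act_mem _ _ _ _ hz hl'
      rw [twist_of_mem M 1 h4, map_zsmul, hh3, twist_of_mem M 1 hl', koszul_add_right,
        koszul_one_one]
      simp
  · refine b.ext fun i => ?_
    rcases i with i | i | j
    · obtain rfl : i = 0 := Subsingleton.elim _ _
      simp [h1, hh1]
    · simp [h2, hh2, hh3]
    · simp [h3, hh3, h2]

/-! ### Endotriviality -/

instance tensor_finiteDimensional (M N : SuperModule k) [FiniteDimensional k M.carrier]
    [FiniteDimensional k N.carrier] : FiniteDimensional k (M.tensor N).carrier :=
  inferInstanceAs (FiniteDimensional k (M.carrier ⊗[k] N.carrier))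

/-- The pure tensor `m ⊗ φ` as an element of the supermodule `M ⊗ M*`. -/
def tensorDualMk (M : SuperModule k) (m : M.carrier) (φ : Module.Dual k M.carrier) :
    (M.tensor M.dual).carrier :=
  (m ⊗ₜ[k] φ : M.carrier ⊗[k] Module.Dual k M.carrier)

theorem tensor_dual_ext (M : SuperModule k) {V : Type*} [AddCommGroup V] [Module k V]
    {f g : (M.tensor M.dual).carrier →ₗ[k] V}
    (h : ∀ m φ, f (M.tensorDualMk m φ) = g (M.tensorDualMk m φ)) : f = g :=
  TensorProduct.ext' (R := k) (M := M.carrier) (N := Module.Dual k M.carrier) h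

theorem act_tensorDualMk (M : SuperModule k) {i : ZMod 2} {z : sl11 k} (hz : z ∈ part k i)
    (m : M.carrier) (φ : Module.Dual k M.carrier) :
    (M.tensor M.dual).act z (M.tensorDualMk m φ) =
      M.tensorDualMk (M.act z m) φ + M.tensorDualMk (M.twist i m) (M.dualAct z φ) :=
  M.tensorAct_tmul M.dual hz m φ

theorem tensor_dual_T (M : SuperModule k) (hT : M.T = 0) : (M.tensor M.dual).T = 0 := by
  refine M.tensor_dual_ext fun m φ => ?_
  have h0 : M.dualAct (t k) φ = 0 :=
    LinearMap.congr_fun (show M.dual.T = 0 from dual_T M hT) φ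
  refine (M.act_tensorDualMk t_mem_part m φ).trans ?_
  rw [h0, show M.act (t k) m = 0 from LinearMap.congr_fun hT m]
  change (0 : M.carrier) ⊗ₜ[k] φ + M.twist 0 m ⊗ₜ[k] (0 : Module.Dual k M.carrier) = 0
  rw [TensorProduct.zero_tmul, TensorProduct.tmul_zero, add_zero]

/-- The supertrace. -/
noncomputable def str (M : SuperModule k) : Module.End k M.carrier →ₗ[k] k :=
  LinearMap.trace k M.carrier ∘ₗ LinearMap.mulLeft k (M.twist 1)

theorem str_apply (M : SuperModule k) (f : Module.End k M.carrier) :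
    M.str f = LinearMap.trace k M.carrier (M.twist 1 * f) := rfl

theorem str_smulRight (M : SuperModule k) [FiniteDimensional k M.carrier]
    (φ : Module.Dual k M.carrier) (m : M.carrier) : M.str (φ.smulRight m) = φ (M.twist 1 m) := by
  have h : M.twist 1 * φ.smulRight m = φ.smulRight (M.twist 1 m) :=
    LinearMap.ext fun v => by simp
  rw [str_apply, h, LinearMap.trace_smulRight]

theorem twist_mul_self (M : SuperModule k) : M.twist 1 * M.twist 1 = 1 :=
  LinearMap.ext fun m => M.twist_twist 1 m

theorem str_supercommutator (M : SuperModule k) (z f : Module.End k M.carrier) :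
    M.str (z * f - M.twist 1 * f * M.twist 1 * z) = 0 := by
  rw [map_sub, str_apply, str_apply, ← mul_assoc, ← mul_assoc, ← mul_assoc, ← mul_assoc,
    twist_mul_self, one_mul, mul_assoc f, LinearMap.trace_mul_comm, sub_self]

section TensorDual
variable (M : SuperModule k) [FiniteDimensional k M.carrier]

/-- The tensor product of `M` with its dual, as the space of endomorphisms of `M`. -/
noncomputable def tensorDualEquiv :
    (M.tensor M.dual).carrier ≃ₗ[k] Module.End k M.carrier :=
  (TensorProduct.comm k M.carrier (Module.Dual k M.carrier)).trans
    (dualTensorHomEquiv k M.carrier M.carrier)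

theorem tensorDualEquiv_tensorDualMk (m : M.carrier) (φ : Module.Dual k M.carrier) :
    M.tensorDualEquiv (M.tensorDualMk m φ) = φ.smulRight m :=
  LinearMap.ext fun v => dualTensorHom_apply φ v m

/-- Under the identification with endomorphisms, an odd element acts by supercommutators. -/
theorem tensorDualEquiv_act {z : sl11 k} (hz : z ∈ part k 1) (w : (M.tensor M.dual).carrier) :
    M.tensorDualEquiv ((M.tensor M.dual).act z w) = M.act z * M.tensorDualEquiv w -
      M.twist 1 * M.tensorDualEquiv w * M.twist 1 * M.act z := by
  let D : Module.End k M.carrier →ₗ[k] Module.End k M.carrier :=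
    LinearMap.mulLeft k (M.act z) -
      LinearMap.mulRight k (M.act z) ∘ₗ LinearMap.mulRight k (M.twist 1) ∘ₗ
        LinearMap.mulLeft k (M.twist 1)
  have h : M.tensorDualEquiv.toLinearMap ∘ₗ (M.tensor M.dual).act z =
      D ∘ₗ M.tensorDualEquiv.toLinearMap := by
    refine M.tensor_dual_ext fun m φ => ?_
    rw [LinearMap.comp_apply, LinearMap.comp_apply, act_tensorDualMk M hz, LinearEquiv.coe_coe,
      map_add, tensorDualEquiv_tensorDualMk, tensorDualEquiv_tensorDualMk,
      tensorDualEquiv_tensorDualMk]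
    refine LinearMap.ext fun v => ?_
    simp [D, M.dualAct_apply hz, sub_eq_add_neg]
  exact LinearMap.congr_fun h w

theorem str_tensorDualEquiv_of_mem {w : (M.tensor M.dual).carrier}
    (hw : w ∈ (M.tensor M.dual).gr 1) : M.str (M.tensorDualEquiv w) = 0 := by
  have h : (M.tensor M.dual).gr 1 ≤
      LinearMap.ker (M.str ∘ₗ M.tensorDualEquiv.toLinearMap) := by
    refine Submodule.span_le.2 ?_
    rintro _ ⟨j, l, hjl, m, hm, φ, hφ, rfl⟩
    change M.str (M.tensorDualEquiv (M.tensorDualMk m (asDual φ))) = 0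
    rw [tensorDualEquiv_tensorDualMk, str_smulRight, twist_of_mem M 1 hm, map_zsmul]
    obtain rfl : j = l + 1 := by clear * - hjl; revert j l; decide
    rw [mem_dual_gr.1 hφ m hm, smul_zero]
  exact h hw

/-- The supertrace as a homomorphism from `M ⊗ M*` to the even trivial supermodule. -/
noncomputable def strHom (hT : M.T = 0) : Hom (M.tensor M.dual) (trivialEven k) :=
  Hom.mk' (N := trivialEven k) (M.str ∘ₗ M.tensorDualEquiv.toLinearMap)
    (fun i w hw => by
      rcases parity_cases i with rfl | rfl
      · trivial
      · exact show M.str (M.tensorDualEquiv w) ∈ (⊥ : Submodule k k) from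
          (Submodule.mem_bot k).2 (M.str_tensorDualEquiv_of_mem hw))
    (fun w => by
      change M.str (M.tensorDualEquiv ((M.tensor M.dual).T w)) = 0
      rw [tensor_dual_T M hT, LinearMap.zero_apply, map_zero, map_zero])
    (fun w => by
      change M.str (M.tensorDualEquiv ((M.tensor M.dual).act (x k) w)) = 0
      rw [tensorDualEquiv_act M x_mem_part, str_supercommutator])
    (fun w => by
      change M.str (M.tensorDualEquiv ((M.tensor M.dual).act (y k) w)) = 0
      rw [tensorDualEquiv_act M y_mem_part, str_supercommutator])

theorem act_tensorDualEquiv_symm_one {z : sl11 k} (hz : z ∈ part k 1) :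
    (M.tensor M.dual).act z (M.tensorDualEquiv.symm 1) = 0 := by
  refine M.tensorDualEquiv.injective ?_
  rw [tensorDualEquiv_act M hz, LinearEquiv.apply_symm_apply, mul_one, mul_one, twist_mul_self,
    one_mul, sub_self, map_zero]

end TensorDual

theorem act_mul_twist_one (M : SuperModule k) {z : sl11 k} (hz : z ∈ part k 1) :
    M.twist 1 * M.act z = -(M.act z * M.twist 1) := by
  rw [twist_mul_act M 1 hz, koszul_one_one, neg_smul, one_smul]

/-- If the Jordan type at `z` is `[1] + a₂[2]`, then the superdimension is `1` or `-1`, because the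
identity is the projection to the trivial summand up to a supercommutator. -/
theorem HasJordanTypeAt.str_one_ne_zero {M : SuperModule k} [FiniteDimensional k M.carrier]
    {z : sl11 k} (hz : z ∈ part k 1) {a₂ : ℕ} (hM : M.HasJordanTypeAt z 1 a₂) :
    M.str 1 ≠ 0 := by
  obtain ⟨h, v, φ, i, hv, hφv, hzv, hφz, hφt, hτh, hzh⟩ := hM.exists_homotopy hz
  have h1 : M.act z * h - M.twist 1 * h * M.twist 1 * M.act z = 1 - φ.smulRight v := by
    rw [hτh, ← hzh, neg_mul, neg_mul, mul_assoc h, twist_mul_self, mul_one]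
    abel
  have h2 := M.str_supercommutator (M.act z) h
  rw [h1, map_sub, sub_eq_zero, str_smulRight, twist_of_mem M 1 hv, map_zsmul, hφv] at h2
  rw [h2]
  intro h3
  have h4 := congrArg (koszul 1 i • ·) h3
  simp only [smul_smul, koszul_mul_self, one_smul, smul_zero] at h4
  exact one_ne_zero h4

/-- If the Jordan type at `z` is `[1] + a₂[2]`, then the supercommutator with `z` is exact on the
endomorphisms of supertrace zero. -/
theorem HasJordanTypeAt.exists_act_tensor_dual {M : SuperModule k} [FiniteDimensional k M.carrier]
    {z : sl11 k} (hz : z ∈ part k 1) {a₂ : ℕ} (hM : M.HasJordanTypeAt z 1 a₂)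
    {w : (M.tensor M.dual).carrier} (hw : (M.tensor M.dual).act z w = 0)
    (hstr : M.str (M.tensorDualEquiv w) = 0) : ∃ w', (M.tensor M.dual).act z w' = w := by
  obtain ⟨h, v, φ, i, hv, hφv, hzv, hφz, hφt, hτh, hzh⟩ := hM.exists_homotopy hz
  set f := M.tensorDualEquiv w with hf
  have h1 := congrArg M.tensorDualEquiv hw
  rw [tensorDualEquiv_act M hz, map_zero] at h1
  have h2 := eq_supercommutator_add (τ := M.twist 1) (z := M.act z) (h := h)
    (p := φ.smulRight v) (f := f) M.twist_mul_self (M.act_mul_twist_one hz) hτh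
    (LinearMap.ext fun m => by
      simp only [Module.End.mul_apply, LinearMap.smulRight_apply, map_smul, hφt,
        twist_of_mem M 1 hv]
      rw [smul_comm, smul_assoc]) hzh
    (LinearMap.ext fun m => by simp [hzv]) (LinearMap.ext fun m => by simp [hφz]) h1
  have h3 : φ.smulRight v * f * φ.smulRight v = φ (f v) • φ.smulRight v :=
    LinearMap.ext fun m => by
      simp only [Module.End.mul_apply, LinearMap.smulRight_apply, map_smul, LinearMap.smul_apply,
        smul_smul, mul_comm]
  -- the supertrace detects the remaining multiple of the projection
  have h4 : φ (f v) = 0 := by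
    have h5 := congrArg M.str h2
    rw [hstr, map_add, str_supercommutator, zero_add, h3, map_smul, str_smulRight, hφt, hφv,
      smul_comm, smul_eq_mul, mul_one] at h5
    have h6 := congrArg (koszul 1 i • ·) h5
    simp only [smul_smul, koszul_mul_self, one_smul, smul_zero] at h6
    exact h6.symm
  rw [h3, h4, zero_smul, add_zero] at h2
  refine ⟨M.tensorDualEquiv.symm (h * f + φ.smulRight v * (M.twist 1 * f * M.twist 1) * h), ?_⟩
  refine M.tensorDualEquiv.injective ?_
  rw [tensorDualEquiv_act M hz, LinearEquiv.apply_symm_apply, ← hf]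
  exact h2.symm

/-- A supermodule of strong constant Jordan type `[1] + a₂[2]` is endotrivial: the endomorphisms of
supertrace zero are a complement of the scalar ones, and they are exact at every odd element. -/
theorem HasStrongConstantJordanType.isEndotrivial [IsAlgClosed k] [CharZero k] {M : SuperModule k}
    [FiniteDimensional k M.carrier] {a₂ : ℕ} (hM : M.HasStrongConstantJordanType 1 a₂) :
    M.IsEndotrivial := by
  have hT := hM.T_eq_zero
  have hNT := tensor_dual_T M hT
  have hx : x k ≠ 0 := by
    have := smul_x_add_smul_y_ne_zero (k := k) (a := 1) (b := 0) (Or.inl one_ne_zero)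
    simpa using this
  have hd := (hM _ x_mem_part hx).str_one_ne_zero x_mem_part
  let N := M.tensor M.dual
  let ε := M.strHom hT
  let e₁ : N.carrier := M.tensorDualEquiv.symm 1
  have he₁ : M.str (M.tensorDualEquiv e₁) = M.str 1 := by
    rw [LinearEquiv.apply_symm_apply]
  -- the identity is even, but it is simpler to pass to its even part
  let e : N.carrier := (M.str 1)⁻¹ • N.proj 0 e₁
  have heX : N.X (N.proj 0 e₁) = 0 := by
    have h := N.proj_X 1 e₁
    rw [show N.X e₁ = 0 from M.act_tensorDualEquiv_symm_one x_mem_part, map_zero] at h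
    exact h.symm
  have heY : N.Y (N.proj 0 e₁) = 0 := by
    have h := N.proj_Y 1 e₁
    rw [show N.Y e₁ = 0 from M.act_tensorDualEquiv_symm_one y_mem_part, map_zero] at h
    exact h.symm
  have he_act : ∀ A, N.act A e = 0 := fun A => by
    rw [act_apply, map_smul, map_smul, map_smul, heX, heY, hNT]
    simp
  have he_str : M.str (M.tensorDualEquiv e) = 1 := by
    have h := congrArg (fun w => M.str (M.tensorDualEquiv w)) (N.proj_add_proj e₁)
    simp only [map_add] at h
    rw [M.str_tensorDualEquiv_of_mem (N.proj_mem 1 e₁), add_zero, he₁] at h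
    change M.str (M.tensorDualEquiv ((M.str 1)⁻¹ • N.proj 0 e₁)) = 1
    rw [map_smul, map_smul, h, smul_eq_mul, inv_mul_cancel₀ hd]
  let Q := N.ofSub (LinearMap.ker ε.toLin) (isSub_ker ε)
  have hQfd : FiniteDimensional k Q.carrier :=
    inferInstanceAs (FiniteDimensional k (LinearMap.ker ε.toLin))
  refine ⟨Q, Q.isProjective_of_exact ?_ ?_, N.isIso_directSum_of_apply_eq_one ε e
    (Submodule.smul_mem _ _ (N.proj_mem 0 e₁)) he_act he_str⟩
  · refine LinearMap.ext fun q => Subtype.ext ?_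
    exact LinearMap.congr_fun hNT q.1
  · rintro z hz hz0 ⟨q, hq⟩ hzq
    have hzq' : N.act z q = 0 := congrArg Subtype.val hzq
    obtain ⟨w, hw⟩ := (hM z hz hz0).exists_act_tensor_dual hz hzq' hq
    refine ⟨⟨w - M.str (M.tensorDualEquiv w) • e, ?_⟩, Subtype.ext ?_⟩
    · change M.str (M.tensorDualEquiv (w - M.str (M.tensorDualEquiv w) • e)) = 0
      rw [map_sub, map_smul, map_sub, map_smul, he_str, smul_eq_mul, mul_one, sub_self]
    · change N.act z (w - M.str (M.tensorDualEquiv w) • e) = q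
      rw [map_sub, map_smul, he_act, smul_zero, sub_zero]
      exact hw

end SuperModule

end SL11

theorem mainTheorem1 {k : Type u} [Field k] [IsAlgClosed k] [CharZero k]
    (M : SL11.SuperModule k) (hF : M.InF) (hind : M.Indecomposable) (hproj : ¬ M.IsProjective)
    (a₁ a₂ : ℕ) (hM : M.HasStrongConstantJordanType a₁ a₂) :
    a₁ = 1 ∧ M.IsEndotrivial ∧
      ∃ n : ℕ, 1 ≤ n ∧
        (M.IsIso (SL11.SuperModule.W k n) ∨
          M.IsIso (SL11.SuperModule.W k n).parityChange ∨
          M.IsIso (SL11.SuperModule.W k n).dual ∨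
          M.IsIso (SL11.SuperModule.W k n).dual.parityChange) := by
  have hfd := hF.1
  obtain ⟨n, hn, h⟩ := hind.exists_isIso hM.T_eq_zero hproj
    (fun z hz hz0 => (hM z hz hz0).finrank_range)
  obtain rfl := hM.eq_one hn h
  exact ⟨rfl, hM.isEndotrivial, n, hn, h⟩
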